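/- A \emph{permutation} is a structure $P=(X,<_0,<_1)$ consisting of a set $X$ and two strict linear orders on $X$. An \emph{embedding} is an injective map that preserves and reflects both relations; a substructure (\emph{subpermutation}) is a subset with the restricted orders. The \emph{age} of $P$ is the class of all finite permutations that embed into $P$. $P$ is \emph{homogeneous} if every isomorphism between finite subpermutations of $P$ extends to an automorphism of $P$. A class $\mathcal K$ of finite structures is a \emph{Ramsey class} if for all $A,B\in\mathcal K$ and $r\in\mathbb N$ there is $C\in\mathcal K$ with $C\to(B)^A_r$, i.e. for every colouring with $r$ colours of the embeddings of $A$ into $C$ there is a substructure $B'\cong B$ of $C$ such that all embeddings of $A$ into $B'$ have the same colour. The empty structure is allowed and belongs to every age. By a \emph{Ramsey class of permutations} we mean a class of finite permutations that is a Ramsey class, is closed under isomorphism, is hereditary (every subpermutation of a member is a member), has the joint embedding property (any two members embed into a common member), and has at least one nonempty member. A finite permutation \emph{has a subpermutation with pattern} $p_1,\dots,p_n$ (distinct numbers) if it contains points $x_1<_1\dots<_1x_n$ such that $x_i<_0x_j$ iff $p_i<p_j$. \textbf{Theorem.} (1) The age of every countable homogeneous permutation is a Ramsey class. (2) A class of finite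 permutations that is closed under isomorphism, hereditary, has the joint embedding property and has a nonempty member is a Ramsey class if and only if it is the age of a countable homogeneous permutation. (3) The Ramsey classes of permutations are exactly the following six classes: the permutations on at most one point; the finite identity permutations (${<_1}={<_0}$); the finite reversals (${<_1}={>_0}$); the finite increasing sequences of decreasing sequences (finite permutations with no subpermutation with pattern $2,3,1$ or $3,1,2$); the finite decreasing sequences of increasing sequences (finite permutations with no subpermutation with pattern $2,1,3$ or $1,3,2$); all finite permutations. (4) Exactly five Ramsey classes of permutations have countably infinitely many members up to isomorphism. -/

import Mathlib

open FirstOrder CategoryTheory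

universe u v w

/-! ### Ramsey classes of relational structures -/

/-- The partition arrow `C → (B)^A_r`: for every colouring with `r` colours of the embeddings of
`A` into `C` there are a colour `i` and a substructure `B'` of `C` isomorphic to `B` such that
every embedding of `A` into `B'` has colour `i`. -/
def PartitionArrow (L : FirstOrder.Language.{u, v}) (C B A : Type w) [L.Structure C] [L.Structure B]
    [L.Structure A] (r : ℕ) : Prop :=
  ∀ χ : (A ↪[L] C) → Fin r, ∃ (i : Fin r) (B' : L.Substructure C),
    Nonempty (B' ≃[L] B) ∧ ∀ f : A ↪[L] B', χ (B'.subtype.comp f) = i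

/-- `K` is a Ramsey class: for all `A, B ∈ K` and every `r` there is `C ∈ K` with
`C → (B)^A_r`. -/
def IsRamseyClass {L : FirstOrder.Language.{u, v}} (K : Set (Bundled.{w} L.Structure)) : Prop :=
  ∀ A ∈ K, ∀ B ∈ K, ∀ r : ℕ, ∃ C ∈ K, PartitionArrow L C B A r

/-! ### Permutations as structures with two linear orders -/

/-- The relation symbols `<₀` and `<₁`, both binary. -/
inductive PermRel : ℕ → Type
  | lt (i : Fin 2) : PermRel 2

/-- The relational signature with two binary relation symbols. -/
def permLang : FirstOrder.Language := ⟨fun _ => Empty, PermRel⟩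

instance : permLang.IsRelational := fun _ => inferInstanceAs (IsEmpty Empty)

/-- The interpretation of the symbol `<ᵢ` in a structure `M`. -/
def permLt {M : Type w} [permLang.Structure M] (i : Fin 2) (x y : M) : Prop :=
  FirstOrder.Language.Structure.RelMap (L := permLang) (PermRel.lt i) ![x, y]

/-- `M` is a permutation: both relations are (strict) linear orders. -/
def IsPermutation (M : Type w) [permLang.Structure M] : Prop :=
  ∀ i : Fin 2, IsStrictTotalOrder M (permLt i)

/-- `M` has a subpermutation with pattern `p`: some points of `M`, listed increasingly with respect
to `<₁`, are ordered by `<₀` as the numbers `p 0, p 1, …` are. -/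
def HasPattern (M : Type w) [permLang.Structure M] {n : ℕ} (p : Fin n → ℕ) : Prop :=
  ∃ x : Fin n → M, ∀ i j : Fin n,
    (permLt 0 (x i) (x j) ↔ p i < p j) ∧ (permLt 1 (x i) (x j) ↔ i < j)

/-! ### Classes of finite permutations -/

/-- All finite permutations. -/
def allPerms : Set (Bundled.{w} permLang.Structure) :=
  {A | Finite A ∧ IsPermutation A}

/-- Permutations on at most one point. -/
def trivialPerms : Set (Bundled.{w} permLang.Structure) :=
  {A | A ∈ allPerms ∧ Subsingleton A}

/-- Finite identity permutations: the two orders agree. -/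
def identityPerms : Set (Bundled.{w} permLang.Structure) :=
  {A | A ∈ allPerms ∧ ∀ x y : A, permLt 1 x y ↔ permLt 0 x y}

/-- Finite reversals: the second order is the reverse of the first. -/
def reversalPerms : Set (Bundled.{w} permLang.Structure) :=
  {A | A ∈ allPerms ∧ ∀ x y : A, permLt 1 x y ↔ permLt 0 y x}

/-- Finite increasing sequences of decreasing sequences. -/
def incDecPerms : Set (Bundled.{w} permLang.Structure) :=
  {A | A ∈ allPerms ∧ ¬ HasPattern A ![2, 3, 1] ∧ ¬ HasPattern A ![3, 1, 2]}

/-- Finite decreasing sequences of increasing sequences. -/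
def decIncPerms : Set (Bundled.{w} permLang.Structure) :=
  {A | A ∈ allPerms ∧ ¬ HasPattern A ![2, 1, 3] ∧ ¬ HasPattern A ![1, 3, 2]}

/-- The classes of finite permutations under consideration: hereditary, closed under isomorphism,
with the joint embedding property, and with at least one nonempty member. -/
structure IsPermutationClass (K : Set (Bundled.{w} permLang.Structure)) : Prop where
  subset_allPerms : K ⊆ allPerms
  exists_nonempty : ∃ A ∈ K, Nonempty A
  isoClosed : ∀ A B : Bundled.{w} permLang.Structure, Nonempty (A ≃[permLang] B) → A ∈ K → B ∈ K
  hereditary : FirstOrder.Language.Hereditary K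
  jointEmbedding : FirstOrder.Language.JointEmbedding K

/-- `K` has countably infinitely many members up to isomorphism. -/
def IsCountablyInfiniteClass (K : Set (Bundled.{w} permLang.Structure)) : Prop :=
  ((Quotient.mk (FirstOrder.Language.equivSetoid (L := permLang))) '' K).Infinite ∧
    ((Quotient.mk (FirstOrder.Language.equivSetoid (L := permLang))) '' K).Countable

/-!
In a Ramsey class with joint embeddings, two extensions of `A` amalgamate: colour each copy of `A`
in a large structure by whether it extends to a copy of the first extension; in a monochromatic
copy of a joint extension of both, the copies of `A` all extend.

A hereditary class with amalgamation is determined by its minimal missing patterns. If such a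
pattern has two points separated by other points in both orders, removing either point leaves
members whose amalgam is forced to be the pattern itself; this leaves only patterns on at most four
points, and chasing these yields the six classes.

Each of the six classes is Ramsey: its members embed into grids cut out of one long chain, a point
being coded by two increasing sequences in that chain, so that copies become subsets of the chain
and the finite Ramsey theorem applies. The homogeneous permutations are the Fraïssé limits.
-/

section Ramsey

open Finset

/-- The arrow `N → (n)ₖ` of the finite Ramsey theorem, with one target size `n c` for each colour
`c`: every colouring of the `k`-subsets of a set with at least `N` elements admits, for some `c`,
a subset of size `n c` all of whose `k`-subsets have colour `c`. The colouring is total on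
`Finset α`; its values off the `k`-subsets do not matter. -/
def IsRamseyBound {κ : Type*} (k : ℕ) (n : κ → ℕ) (N : ℕ) : Prop :=
  ∀ ⦃α : Type u⦄ (s : Finset α), N ≤ #s → ∀ χ : Finset α → κ,
    ∃ c, ∃ t ⊆ s, #t = n c ∧ ∀ u ⊆ t, #u = k → χ u = c

variable {κ : Type*} {k : ℕ} {n : κ → ℕ}

theorem IsRamseyBound.succ [DecidableEq κ] {N : κ → ℕ} {R : ℕ} (hn : ∀ c, n c ≠ 0)
    (hN : ∀ c, IsRamseyBound.{u} (k + 1) (Function.update n c (n c - 1)) (N c))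
    (hR : IsRamseyBound.{u} k N R) : IsRamseyBound.{u} (k + 1) n (R + 1) := by
  classical
  intro α s hs χ
  obtain ⟨a, ha⟩ : s.Nonempty := card_pos.1 (by lia)
  obtain ⟨c, t, hts, htc, ht⟩ := hR (s.erase a) (by rw [card_erase_of_mem ha]; lia)
    fun u => χ (insert a u)
  obtain ⟨d, t', ht't, ht'd, ht'⟩ := hN c t htc.ge χ
  have ht's : t' ⊆ s.erase a := ht't.trans hts
  rcases eq_or_ne d c with rfl | hdc
  · have hat' : a ∉ t' := fun h => notMem_erase a s (ht's h)
    rw [Function.update_self] at ht'd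
    refine ⟨d, insert a t', insert_subset ha (ht's.trans (erase_subset a s)), ?_,
      fun u hu huk => ?_⟩
    · rw [card_insert_of_notMem hat', ht'd]
      exact Nat.succ_pred (hn d)
    · by_cases hau : a ∈ u
      · rw [← insert_erase hau]
        refine ht _ (Subset.trans ?_ ht't) (by rw [card_erase_of_mem hau, huk, Nat.add_sub_cancel])
        exact (erase_subset_erase a hu).trans (erase_insert_subset a t')
      · exact ht' u ((subset_insert_iff_of_notMem hau).1 hu) huk
  · rw [Function.update_of_ne hdc] at ht'd
    exact ⟨d, t', ht's.trans (erase_subset a s), ht'd, ht'⟩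

theorem exists_isRamseyBound [Finite κ] [Nonempty κ] (k : ℕ) (n : κ → ℕ) :
    ∃ N, IsRamseyBound.{u} k n N := by
  classical
  have := Fintype.ofFinite κ
  induction k generalizing n with
  | zero =>
    refine ⟨∑ c, n c, fun α s hs χ => ?_⟩
    obtain ⟨t, hts, htn⟩ :=
      exists_subset_card_eq ((single_le_sum_of_canonicallyOrdered (mem_univ (χ ∅))).trans hs)
    exact ⟨χ ∅, t, hts, htn, fun u _ hu => by rw [card_eq_zero.1 hu]⟩
  | succ k ih =>
    induction hm : ∑ c, n c using Nat.strong_induction_on generalizing n with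
    | _ m ihm =>
    by_cases hn : ∀ c, n c ≠ 0
    · have hlt (c : κ) : ∑ d, Function.update n c (n c - 1) d < m := by
        rw [← hm]
        refine sum_lt_sum (fun d _ => ?_) ⟨c, mem_univ c, ?_⟩
        · rcases eq_or_ne d c with rfl | hdc <;> simp [*]
        · simpa using Nat.pos_of_ne_zero (hn c)
      choose N hN using fun c => ihm _ (hlt c) _ rfl
      obtain ⟨R, hR⟩ := ih N
      exact ⟨R + 1, .succ hn hN hR⟩
    · push Not at hn
      obtain ⟨c, hc⟩ := hn
      exact ⟨0, fun α s _ χ => ⟨c, ∅, empty_subset s, by simp [hc], by simp +contextual⟩⟩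

theorem exists_orderEmbedding_forall_trans_eq (W V : Type*) [LinearOrder W] [LinearOrder V]
    [Finite W] [Finite V] (κ : Type*) [Finite κ] [Nonempty κ] :
    ∃ N : ℕ, ∀ χ : (W ↪o Fin N) → κ, ∃ c, ∃ e : V ↪o Fin N, ∀ g : W ↪o V, χ (g.trans e) = c := by
  classical
  have := Fintype.ofFinite W
  have := Fintype.ofFinite V
  obtain ⟨N, hN⟩ := exists_isRamseyBound.{0} (Fintype.card W) fun _ : κ => Fintype.card V
  refine ⟨N, fun χ => ?_⟩
  let χ' (u : Finset (Fin N)) : κ :=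
    if h : ∃ g : W ↪o Fin N, univ.image g = u then χ h.choose else Classical.arbitrary κ
  have hχ' (g : W ↪o Fin N) : χ' (univ.image g) = χ g := by
    have h : ∃ f : W ↪o Fin N, univ.image f = univ.image g := ⟨g, rfl⟩
    have hfg : h.choose = g := by
      refine DFunLike.coe_injective ((h.choose.strictMono.range_inj g.strictMono).1 ?_)
      simpa only [coe_image, coe_univ, Set.image_univ] using
        congrArg (fun u : Finset (Fin N) => (u : Set (Fin N))) h.choose_spec
    simp only [χ', dif_pos h, hfg]
  obtain ⟨c, t, -, htc, ht⟩ := hN univ (by simp) χ'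
  let e : V ↪o Fin N :=
    (Fintype.orderIsoFinOfCardEq V rfl).symm.toOrderEmbedding.trans (t.orderEmbOfFin htc)
  refine ⟨c, e, fun g => ?_⟩
  rw [← hχ', ht]
  · exact image_subset_iff.2 fun w _ => t.orderEmbOfFin_mem htc _
  · rw [card_image_of_injective _ (g.trans e).injective, card_univ]

end Ramsey

section Structures

open FirstOrder.Language

variable {L : FirstOrder.Language.{u, v}} {K : Set (Bundled.{w} L.Structure)}

theorem partitionArrow_iff {C B A : Type w} [L.Structure C] [L.Structure B] [L.Structure A]
    {r : ℕ} : PartitionArrow L C B A r ↔ ∀ χ : (A ↪[L] C) → Fin r,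
      ∃ (i : Fin r) (e : B ↪[L] C), ∀ f : A ↪[L] B, χ (e.comp f) = i := by
  refine forall_congr' fun χ => exists_congr fun i => ⟨?_, ?_⟩
  · rintro ⟨B', ⟨φ⟩, hi⟩
    exact ⟨B'.subtype.comp φ.symm.toEmbedding, fun f => hi (φ.symm.toEmbedding.comp f)⟩
  · rintro ⟨e, hi⟩
    refine ⟨e.toHom.range, ⟨e.equivRange.symm⟩, fun f => ?_⟩
    rw [← hi (e.equivRange.symm.toEmbedding.comp f)]
    congr 1
    ext a
    exact congrArg Subtype.val (e.equivRange.apply_symm_apply (f a)).symm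

theorem IsRamseyClass.amalgamation (hK : IsRamseyClass K) (hjep : JointEmbedding K) :
    Amalgamation K := by
  classical
  intro A B₁ B₂ e₁ e₂ hA hB₁ hB₂
  obtain ⟨B, hB, ⟨j₁⟩, ⟨j₂⟩⟩ := hjep B₁ hB₁ B₂ hB₂
  obtain ⟨C, hC, hCB⟩ := hK A hA B hB 2
  obtain ⟨i, e, he⟩ := partitionArrow_iff.1 hCB fun f =>
    if ∃ g : B₁ ↪[L] C, g.comp e₁ = f then 0 else 1
  have hi : i = 0 := by
    rw [← he (j₁.comp e₁), if_pos ⟨e.comp j₁, Embedding.comp_assoc ..⟩]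
  obtain ⟨g, hg⟩ : ∃ g : B₁ ↪[L] C, g.comp e₁ = e.comp (j₂.comp e₂) := by
    by_contra hg
    simpa [hi, if_neg hg] using he (j₂.comp e₂)
  exact ⟨C, g, e.comp j₂, hC, by rw [hg, Embedding.comp_assoc]⟩

theorem exists_amalgam_of_finite {ι : Type*} [Finite ι] (hK : Amalgamation K)
    {P : Bundled.{w} L.Structure} (hP : P ∈ K) {A C : ι → Bundled.{w} L.Structure}
    (hA : ∀ t, A t ∈ K) (hC : ∀ t, C t ∈ K) (e : ∀ t, A t ↪[L] C t) (f : ∀ t, A t ↪[L] P) :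
    ∃ Q ∈ K, ∃ i : P ↪[L] Q, ∀ t, ∃ g : C t ↪[L] Q, g.comp (e t) = i.comp (f t) := by
  suffices ∀ s : Set ι, s.Finite → ∃ Q ∈ K, ∃ i : P ↪[L] Q,
      ∀ t ∈ s, ∃ g : C t ↪[L] Q, g.comp (e t) = i.comp (f t) by
    simpa using this Set.univ Set.finite_univ
  intro s hs
  induction s, hs using Set.Finite.induction_on with
  | empty => exact ⟨P, hP, Embedding.refl L P, by simp⟩
  | @insert t s _ _ ih =>
    obtain ⟨Q, hQ, i, hi⟩ := ih
    obtain ⟨Q', g, j, hQ', hgj⟩ := hK (A t) (C t) Q (e t) (i.comp (f t)) (hA t) (hC t) hQ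
    refine ⟨Q', hQ', j.comp i, Set.forall_mem_insert.2 ⟨⟨g, hgj⟩, fun t' ht' => ?_⟩⟩
    obtain ⟨g', hg'⟩ := hi t' ht'
    exact ⟨j.comp g', by rw [Embedding.comp_assoc, hg', Embedding.comp_assoc]⟩

/-- The embedding `i : P → Q` solves every extension problem posed by `C` over `P`: an embedding
into `P` of a structure embedded in `C` extends, after composing with `i`, to all of `C`. One step
towards an ultrahomogeneous limit. -/
def ExtendsEmbeddings {P Q : Type w} [L.Structure P] [L.Structure Q] (i : P ↪[L] Q) (C : Type w)
    [L.Structure C] : Prop :=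
  ∀ (A : Bundled.{w} L.Structure) (e : A ↪[L] C) (f : A ↪[L] P),
    ∃ g : C ↪[L] Q, g.comp e = i.comp f

theorem exists_extendsEmbeddings (hK : Amalgamation K) (hfin : ∀ A ∈ K, Finite A)
    (hher : Hereditary K) {P : Bundled.{w} L.Structure} (hP : P ∈ K) {ι : Type*} [Finite ι]
    {C : ι → Bundled.{w} L.Structure} (hC : ∀ t, C t ∈ K) :
    ∃ Q ∈ K, ∃ i : P ↪[L] Q, ∀ t, ExtendsEmbeddings i (C t) := by
  have (t : ι) : Finite (C t) := hfin _ (hC t)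
  have : Finite P := hfin P hP
  have (t : ι) : Finite (L.Substructure (C t)) := Finite.of_injective _ SetLike.coe_injective
  have (t : ι) (S : L.Substructure (C t)) : Finite (S ↪[L] P) :=
    Finite.of_injective _ DFunLike.coe_injective
  have hS (t : ι) (S : L.Substructure (C t)) : Bundled.mk S ∈ K :=
    hher _ (hC t) ⟨Structure.FG.of_finite, ⟨S.subtype⟩⟩
  obtain ⟨Q, hQ, i, hi⟩ := exists_amalgam_of_finite (ι := Σ t, Σ S : L.Substructure (C t), S ↪[L] P)
    hK hP (fun t => hS t.1 t.2.1) (fun t => hC t.1) (fun t => t.2.1.subtype) fun t => t.2.2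
  refine ⟨Q, hQ, i, fun t A e f => ?_⟩
  obtain ⟨g, hg⟩ := hi ⟨t, e.toHom.range, f.comp e.equivRange.symm.toEmbedding⟩
  refine ⟨g, ?_⟩
  ext a
  simpa using DFunLike.congr_fun hg (e.equivRange a)

theorem exists_extendsEmbeddings_sequence [hK : IsFraisse K] (hfin : ∀ A ∈ K, Finite A)
    (F : ℕ → K) : ∃ (P : ℕ → K) (i : ∀ n, (P n).1 ↪[L] (P (n + 1)).1),
      (∀ n, Nonempty ((F n).1 ↪[L] (P (n + 1)).1)) ∧
      ∀ n, ∀ k ≤ n, ExtendsEmbeddings (i n) (F k).1 := by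
  have step (n : ℕ) (P : K) : ∃ (Q : K) (i : P.1 ↪[L] Q.1),
      Nonempty ((F n).1 ↪[L] Q.1) ∧ ∀ k ≤ n, ExtendsEmbeddings i (F k).1 := by
    obtain ⟨P', hP', ⟨j⟩, ⟨j'⟩⟩ := hK.jointEmbedding P.1 P.2 (F n).1 (F n).2
    obtain ⟨Q, hQ, i, hi⟩ := exists_extendsEmbeddings hK.amalgamation hfin hK.hereditary hP'
      fun k : Fin (n + 1) => (F k).2
    refine ⟨⟨Q, hQ⟩, i.comp j, ⟨i.comp j'⟩, fun k hk A e f => ?_⟩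
    obtain ⟨g, hg⟩ := hi ⟨k, Nat.lt_succ_of_le hk⟩ A e (j.comp f)
    exact ⟨g, hg.trans (Embedding.comp_assoc ..).symm⟩
  choose Q i hF hi using step
  exact ⟨fun n => Nat.rec (F 0) (fun n P => Q n P) n, fun n => i n _, fun n => hF n _,
    fun n => hi n _⟩

theorem isUltrahomogeneous_of_exists_comp_eq {M : Type w} [L.Structure M] (hM : Structure.CG L M)
    (h : ∀ C ∈ L.age M, ∀ (A : Bundled.{w} L.Structure) (e : A ↪[L] C) (f : A ↪[L] M),
      ∃ g : C ↪[L] M, g.comp e = f) : L.IsUltrahomogeneous M := by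
  rw [isUltrahomogeneous_iff_IsExtensionPair hM,
    isExtensionPair_iff_exists_embedding_closure_singleton_sup]
  intro S hS f m
  obtain ⟨g, hg⟩ := h ⟨_, inferInstance⟩
    (age.fg_substructure ((Substructure.fg_closure_singleton m).sup hS)) ⟨S, inferInstance⟩
    (Substructure.inclusion le_sup_right) f
  exact ⟨g, hg.symm⟩

theorem exists_directLimit_of_comp_eq {ι : Type*} [Preorder ι] [Nonempty ι] [IsDirectedOrder ι]
    {G : ι → Type w} [∀ i, L.Structure (G i)] {f : ∀ i j, i ≤ j → G i ↪[L] G j}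
    [DirectedSystem G fun i j h => f i j h] {A : Type*} [L.Structure A] (hA : Structure.FG L A)
    (φ : A ↪[L] Language.DirectLimit G f) (k : ι) :
    ∃ i ≥ k, ∃ ψ : A ↪[L] G i, (DirectLimit.of L ι G f i).comp ψ = φ := by
  obtain ⟨j, T, hT⟩ := DirectLimit.exists_fg_substructure_in_Sigma _ (hA.range φ.toHom)
  obtain ⟨i, hji, hki⟩ := exists_ge_ge j k
  have hφ : φ.toHom.range ≤ (DirectLimit.of L ι G f i).toHom.range := by
    rw [← hT, Substructure.map_le_iff_le_comap]
    exact fun x _ => ⟨f j i hji x, DirectLimit.of_f⟩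
  refine ⟨i, hki, (DirectLimit.of L ι G f i).equivRange.symm.toEmbedding.comp
    ((Substructure.inclusion hφ).comp φ.equivRange.toEmbedding), ?_⟩
  ext a
  exact congrArg Subtype.val ((DirectLimit.of L ι G f i).equivRange.apply_symm_apply _)

theorem exists_nat_forall_exists_equiv [hK : IsFraisse K] :
    ∃ F : ℕ → K, ∀ A ∈ K, ∃ n, Nonempty ((F n).1 ≃[L] A) := by
  obtain ⟨q, hq⟩ := hK.is_essentially_countable.exists_eq_range (hK.is_nonempty.image _)
  choose F hF hFq using fun n => hq ▸ Set.mem_range_self n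
  refine ⟨fun n => ⟨F n, hF n⟩, fun A hA => ?_⟩
  obtain ⟨n, hn⟩ : Quotient.mk' A ∈ Set.range q := hq ▸ Set.mem_image_of_mem _ hA
  exact ⟨n, Quotient.exact ((hFq n).trans hn)⟩

theorem exists_isUltrahomogeneous_age_eq [hK : IsFraisse K] (hfin : ∀ A ∈ K, Finite A) :
    ∃ M : Bundled.{w} L.Structure, Countable M ∧ L.IsUltrahomogeneous M ∧ L.age M = K := by
  obtain ⟨F, hF⟩ := exists_nat_forall_exists_equiv (K := K)
  obtain ⟨P, i, hFP, hi⟩ := exists_extendsEmbeddings_sequence hfin F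
  let G (n : ℕ) : Type w := (P n).1
  let f : ∀ m n, m ≤ n → G m ↪[L] G n := DirectedSystem.natLERec i
  have hf (n : ℕ) (x : G n) : f n (n + 1) n.le_succ x = i n x := by
    rw [DirectedSystem.coe_natLERec]
    exact Nat.leRecOn_succ' x
  let M := Language.DirectLimit G f
  have (n : ℕ) : Finite (G n) := hfin _ (P n).2
  have hM : Countable M := Function.Surjective.countable
    (f := fun x : Σ n, G n => DirectLimit.of L ℕ G f x.1 x.2) fun z =>
      let ⟨n, x, hx⟩ := DirectLimit.exists_of z
      ⟨⟨n, x⟩, hx⟩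
  have hage : L.age M = K := by
    refine (age_directLimit G f).trans (subset_antisymm ?_ fun A hA => ?_)
    · exact Set.iUnion_subset fun n => hK.hereditary _ (P n).2
    · obtain ⟨n, ⟨e⟩⟩ := hF A hA
      exact Set.mem_iUnion.2 ⟨n + 1, hK.FG A hA, ⟨(hFP n).some.comp e.symm.toEmbedding⟩⟩
  refine ⟨⟨M, inferInstance⟩, hM,
    isUltrahomogeneous_of_exists_comp_eq Structure.cg_of_countable fun C hC A e φ => ?_, hage⟩
  obtain ⟨k, ⟨j⟩⟩ := hF C (hage ▸ hC)
  have : Finite C := hfin C (hage ▸ hC)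
  have : Finite A := .of_injective e e.injective
  obtain ⟨n, hn, ψ, rfl⟩ := exists_directLimit_of_comp_eq Structure.FG.of_finite φ k
  obtain ⟨g, hg⟩ := hi n k hn A (j.symm.toEmbedding.comp e) ψ
  refine ⟨(DirectLimit.of L ℕ G f (n + 1)).comp (g.comp j.symm.toEmbedding), ?_⟩
  rw [Embedding.comp_assoc, Embedding.comp_assoc, hg]
  ext a
  rw [Embedding.comp_apply, Embedding.comp_apply, Embedding.comp_apply, ← hf]
  exact DirectLimit.of_f

end Structures

section Permutations

open FirstOrder.Language

variable {M : Type u} {N : Type v} [permLang.Structure M] [permLang.Structure N] {i : Fin 2}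

theorem permLt_irrefl (hM : IsPermutation M) (i : Fin 2) (x : M) : ¬ permLt i x x :=
  (hM i).toIrrefl.irrefl x

theorem permLt_trans (hM : IsPermutation M) {x y z : M} (hxy : permLt i x y)
    (hyz : permLt i y z) : permLt i x z :=
  (hM i).toIsTrans.trans x y z hxy hyz

theorem permLt_asymm (hM : IsPermutation M) {x y : M} (hxy : permLt i x y) : ¬ permLt i y x :=
  fun hyx => permLt_irrefl hM i x (permLt_trans hM hxy hyx)

theorem permLt_trichotomous (hM : IsPermutation M) (i : Fin 2) (x y : M) :
    permLt i x y ∨ x = y ∨ permLt i y x :=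
  have := hM i
  trichotomous_of (permLt i) x y

theorem relMap_permLt (i : Fin 2) (x : Fin 2 → M) :
    Structure.RelMap (L := permLang) (PermRel.lt i) x ↔ permLt i (x 0) (x 1) := by
  have hx : x = ![x 0, x 1] := by ext j; fin_cases j <;> rfl
  rw [permLt, ← hx]

@[simp]
theorem permLt_apply_apply (f : M ↪[permLang] N) {x y : M} :
    permLt i (f x) (f y) ↔ permLt i x y := by
  have := f.map_rel (PermRel.lt i) ![x, y]
  rwa [relMap_permLt, relMap_permLt] at this

/-- The embedding given by an injective map that preserves and reflects both orders. -/
def permEmbedding (f : M ↪ N) (hf : ∀ i x y, permLt i (f x) (f y) ↔ permLt i x y) :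
    M ↪[permLang] N where
  toEmbedding := f
  map_fun' := fun g => Empty.elim g
  map_rel' := by
    rintro _ ⟨i⟩ x
    simp only [relMap_permLt]
    exact hf i _ _

/-- The isomorphism given by a bijection that preserves and reflects both orders. -/
def permEquiv (e : M ≃ N) (he : ∀ i x y, permLt i (e x) (e y) ↔ permLt i x y) :
    M ≃[permLang] N where
  toEquiv := e
  map_fun' := fun g => Empty.elim g
  map_rel' := (permEmbedding e.toEmbedding he).map_rel'

/-- Between permutations, a map that preserves both orders is an embedding. -/
def IsPermutation.embedding (hM : IsPermutation M) (hN : IsPermutation N) (f : M → N)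
    (hf : ∀ i x y, permLt i x y → permLt i (f x) (f y)) : M ↪[permLang] N :=
  permEmbedding
    ⟨f, fun x y hxy => ((permLt_trichotomous hM 0 x y).resolve_left fun h =>
      permLt_irrefl hN 0 _ (hxy ▸ hf 0 x y h)).resolve_right fun h =>
      permLt_irrefl hN 0 _ (hxy ▸ hf 0 y x h)⟩
    fun i x y => ⟨fun h => by
      rcases permLt_trichotomous hM i x y with hxy | rfl | hyx
      · exact hxy
      · exact absurd h (permLt_irrefl hN i _)
      · exact absurd h (permLt_asymm hN (hf i y x hyx)), hf i x y⟩

theorem IsPermutation.of_embedding (hN : IsPermutation N) (f : M ↪[permLang] N) :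
    IsPermutation M := fun i =>
  have := hN i
  RelEmbedding.isStrictTotalOrder (r := permLt i) (s := permLt i)
    ⟨f.toEmbedding, permLt_apply_apply f⟩

theorem HasPattern.of_embedding (f : M ↪[permLang] N) {n : ℕ} {p : Fin n → ℕ} :
    HasPattern M p → HasPattern N p := fun ⟨x, hx⟩ =>
  ⟨f ∘ x, fun i j => by simpa only [Function.comp_apply, permLt_apply_apply] using hx i j⟩

theorem IsPermutation.hasPattern (hM : IsPermutation M) {n : ℕ} {p : Fin n → ℕ}
    (hp : Function.Injective p) (x : Fin n → M) (h₀ : ∀ i j, p i < p j → permLt 0 (x i) (x j))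
    (h₁ : ∀ i j, i < j → permLt 1 (x i) (x j)) : HasPattern M p :=
  ⟨x, fun i j => ⟨⟨fun h => by_contra fun hij => permLt_asymm hM h <| h₀ j i <|
      (not_lt.1 hij).lt_of_ne fun hji => permLt_irrefl hM 0 _ (hp hji ▸ h), h₀ i j⟩,
    ⟨fun h => by_contra fun hij => permLt_asymm hM h <| h₁ j i <|
      (not_lt.1 hij).lt_of_ne fun hji => permLt_irrefl hM 1 _ (hji ▸ h), h₁ i j⟩⟩⟩

theorem mem_allPerms_of_embedding {A B : Bundled.{w} permLang.Structure} (f : A ↪[permLang] B)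
    (hB : B ∈ allPerms) : A ∈ allPerms :=
  have := hB.1
  ⟨Finite.of_injective f f.injective, hB.2.of_embedding f⟩

end Permutations

section Constructions

variable {M : Type w}

/-- The structure with prescribed interpretations of `<₀` and `<₁`. -/
@[reducible]
def permStr (lt : Fin 2 → M → M → Prop) : permLang.Structure M where
  funMap := fun f => Empty.elim f
  RelMap := fun {n} R => match n, R with
    | _, PermRel.lt i => fun v => lt i (v 0) (v 1)

theorem permStr_permLt (S : permLang.Structure M) : permStr (fun i x y => permLt i x y) = S := by
  apply Language.Structure.ext
  · funext n f
    exact Empty.elim f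
  · funext n ⟨i⟩ x
    exact propext (relMap_permLt i x).symm

/-- The structure whose orders `<₀` and `<₁` are pulled back along `f` and `g`; it is a permutation
when both maps are injective. -/
def permOf {α β : Type*} [LT α] [LT β] (f : M → α) (g : M → β) : Bundled.{w} permLang.Structure :=
  ⟨M, permStr ![fun x y => f x < f y, fun x y => g x < g y]⟩

theorem permOf_mem_allPerms [Finite M] {α β : Type*} [LinearOrder α] [LinearOrder β] {f : M → α}
    {g : M → β} (hf : Function.Injective f) (hg : Function.Injective g) : permOf f g ∈ allPerms :=
  ⟨‹Finite M›, fun i => match i with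
    | 0 => (RelEmbedding.preimage ⟨f, hf⟩ (· < ·)).isStrictTotalOrder
    | 1 => (RelEmbedding.preimage ⟨g, hg⟩ (· < ·)).isStrictTotalOrder⟩

/-- The finite permutation with pattern `p`. -/
def patPerm {n : ℕ} (p : Fin n → ℕ) : Bundled.{w} permLang.Structure :=
  permOf (M := ULift.{w} (Fin n)) (fun x => p x.down) ULift.down

theorem patPerm_mem_allPerms {n : ℕ} {p : Fin n → ℕ} (hp : Function.Injective p) :
    patPerm.{w} p ∈ allPerms :=
  permOf_mem_allPerms (hp.comp ULift.down_injective) ULift.down_injective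

theorem patPerm_congr {n : ℕ} {p q : Fin n → ℕ} (h : ∀ i j, p i < p j ↔ q i < q j) :
    patPerm.{w} p = patPerm q := by
  simp only [patPerm, permOf, h]

theorem hasPattern_patPerm_iff {m n : ℕ} {q : Fin m → ℕ} {p : Fin n → ℕ} :
    HasPattern (patPerm.{w} q) p ↔
      ∃ x : Fin n → Fin m, ∀ i j, (q (x i) < q (x j) ↔ p i < p j) ∧ (x i < x j ↔ i < j) :=
  ⟨fun ⟨x, hx⟩ => ⟨fun i => (x i).down, hx⟩, fun ⟨x, hx⟩ => ⟨fun i => ULift.up (x i), hx⟩⟩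

theorem HasPattern.nonempty_embedding {N : Type v} [permLang.Structure N] {n : ℕ}
    {p : Fin n → ℕ} : HasPattern N p → Nonempty (patPerm.{w} p ↪[permLang] N) := by
  rintro ⟨x, hx⟩
  have hlt : ∀ i j, i < j → x i ≠ x j := fun i j hij h =>
    lt_irrefl i ((hx i i).2.1 (h ▸ (hx i j).2.2 hij))
  have hinj : Function.Injective x := fun i j h => by_contra fun hij =>
    (lt_or_gt_of_ne hij).elim (fun hij => hlt i j hij h) (fun hji => hlt j i hji h.symm)
  exact ⟨permEmbedding (M := patPerm.{w} p) ⟨fun i => x i.down, hinj.comp ULift.down_injective⟩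
    fun i a b => match i with
      | 0 => (hx a.down b.down).1
      | 1 => (hx a.down b.down).2⟩

theorem exists_equiv_fin_rel_iff_lt {α : Type*} [Finite α] (r : α → α → Prop)
    [IsStrictTotalOrder α r] : ∃ e : Fin (Nat.card α) ≃ α, ∀ i j, r (e i) (e j) ↔ i < j := by
  classical
  let := Fintype.ofFinite α
  let := linearOrderOfSTO r
  let e := Fintype.orderIsoFinOfCardEq α Nat.card_eq_fintype_card.symm
  exact ⟨e.toEquiv, fun i j => e.lt_iff_lt⟩

theorem exists_perm_equiv_patPerm {A : Bundled.{w} permLang.Structure} (hA : A ∈ allPerms) :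
    ∃ σ : Equiv.Perm (Fin (Nat.card A)),
      Nonempty (patPerm.{w} (fun i => (σ i : ℕ)) ≃[permLang] A) := by
  have := hA.1
  have := hA.2 0
  have := hA.2 1
  obtain ⟨e₀, he₀⟩ := exists_equiv_fin_rel_iff_lt (permLt (M := A) 0)
  obtain ⟨e₁, he₁⟩ := exists_equiv_fin_rel_iff_lt (permLt (M := A) 1)
  refine ⟨e₁.trans e₀.symm, ⟨permEquiv (Equiv.ulift.trans e₁) fun i x y => ?_⟩⟩
  match i with
  | 0 =>
    have h := he₀ (e₀.symm (e₁ x.down)) (e₀.symm (e₁ y.down))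
    simp only [Equiv.apply_symm_apply] at h
    exact h
  | 1 => exact he₁ x.down y.down

/-- The permutation with the order `<₁` reversed. -/
def flipPerm (A : Bundled.{w} permLang.Structure) : Bundled.{w} permLang.Structure :=
  ⟨A, permStr ![fun x y => permLt 0 x y, fun x y => permLt 1 y x]⟩

theorem flipPerm_flipPerm (A : Bundled.{w} permLang.Structure) : flipPerm (flipPerm A) = A := by
  obtain ⟨M, S⟩ := A
  have hS : (flipPerm (flipPerm ⟨M, S⟩)).str = permStr fun i x y => permLt (M := M) i x y :=
    congrArg permStr (funext fun i => match i with | 0 => rfl | 1 => rfl)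
  exact congrArg (fun T => (⟨M, T⟩ : Bundled.{w} permLang.Structure)) (hS.trans (permStr_permLt S))

/-- An embedding, regarded as an embedding of the permutations with `<₁` reversed. -/
def flipEmbedding {A B : Bundled.{w} permLang.Structure} (f : A ↪[permLang] B) :
    flipPerm A ↪[permLang] flipPerm B :=
  permEmbedding (M := flipPerm A) (N := flipPerm B) f.toEmbedding fun i _ _ => match i with
    | 0 => permLt_apply_apply f
    | 1 => permLt_apply_apply f

theorem flipPerm_mem_allPerms {A : Bundled.{w} permLang.Structure} (hA : A ∈ allPerms) :
    flipPerm A ∈ allPerms :=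
  ⟨hA.1, fun i => match i with
    | 0 => hA.2 0
    | 1 => have := hA.2 1; inferInstanceAs (IsStrictTotalOrder A (Function.swap (permLt 1)))⟩

theorem flipPerm_mem_allPerms_iff {A : Bundled.{w} permLang.Structure} :
    flipPerm A ∈ allPerms ↔ A ∈ allPerms :=
  ⟨fun h => flipPerm_flipPerm A ▸ flipPerm_mem_allPerms h, flipPerm_mem_allPerms⟩

theorem hasPattern_flipPerm_iff {A : Bundled.{w} permLang.Structure} {n : ℕ} {p : Fin n → ℕ} :
    HasPattern (flipPerm A) p ↔ HasPattern A (p ∘ Fin.rev) := by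
  constructor
  · rintro ⟨x, hx⟩
    exact ⟨x ∘ Fin.rev, fun i j => ⟨(hx i.rev j.rev).1, (hx j.rev i.rev).2.trans Fin.rev_lt_rev⟩⟩
  · rintro ⟨x, hx⟩
    refine ⟨x ∘ Fin.rev, fun i j => ⟨?_, (hx j.rev i.rev).2.trans Fin.rev_lt_rev⟩⟩
    have h := (hx i.rev j.rev).1
    simp only [Function.comp_apply, Fin.rev_rev] at h
    exact h

theorem reversalPerms_eq : reversalPerms.{w} = {A | flipPerm A ∈ identityPerms} :=
  Set.ext fun _ => and_congr flipPerm_mem_allPerms_iff.symm forall_comm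

theorem decIncPerms_eq : decIncPerms.{w} = {A | flipPerm A ∈ incDecPerms} := by
  have h231 : ![2, 3, 1] ∘ Fin.rev = ![1, 3, 2] := by decide
  have h312 : ![3, 1, 2] ∘ Fin.rev = ![2, 1, 3] := by decide
  ext A
  simp only [decIncPerms, incDecPerms, Set.mem_ofPred_eq, flipPerm_mem_allPerms_iff,
    hasPattern_flipPerm_iff, h231, h312, and_comm]

end Constructions

section Coding

theorem ncard_setOf_rel_lt_iff {α : Type*} [Finite α] (r : α → α → Prop) [Std.Asymm r]
    [IsOrderConnected α r] {x y : α} : {z | r z x}.ncard < {z | r z y}.ncard ↔ r x y := by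
  refine ⟨fun h => by_contra fun hxy => h.not_ge (Set.ncard_le_ncard fun z hz => ?_),
    fun hxy => Set.ncard_lt_ncard ⟨fun z hz => ?_, fun hyx => asymm (hyx hxy) (hyx hxy)⟩⟩
  · exact (IsOrderConnected.conn z x y hz).resolve_right hxy
  · exact (IsOrderConnected.conn z y x hz).resolve_right (asymm hxy)

theorem exists_range_orderEmbedding {X Y α β : Type*} [LinearOrder α] [LinearOrder β] {a : X → α}
    {b : Y → β} (f : X → Y) (h : ∀ x y, b (f x) < b (f y) ↔ a x < a y) :
    ∃ g : Set.range a ↪o Set.range b,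
      ∀ x, g (Set.rangeFactorization a x) = Set.rangeFactorization b (f x) := by
  have hle (x y : X) : b (f x) ≤ b (f y) ↔ a x ≤ a y := by
    simpa only [not_lt] using not_congr (h y x)
  choose s hs using fun t : Set.range a => t.2
  refine ⟨OrderEmbedding.ofMapLEIff (fun t => Set.rangeFactorization b (f (s t))) fun t t' => ?_,
    fun x => Subtype.ext ?_⟩
  · exact (hle _ _).trans (by rw [hs, hs, Subtype.coe_le_coe])
  · have hsx := hs (Set.rangeFactorization a x)
    exact le_antisymm ((hle _ _).2 hsx.le) ((hle _ _).2 hsx.ge)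

/-- A coding of the members of `K` by points of square grids. Every member carries two weak orders,
invariant under embeddings, and each choice of coordinates in `Fin N` compatible with them is
realised by an embedding into a fixed member `grid N`. Embeddings into `grid N` are thereby given
by increasing sequences, to which the finite Ramsey theorem applies. -/
structure GridCoding (K : Set (Bundled.{w} permLang.Structure)) where
  subset_allPerms : K ⊆ allPerms
  mem_of_embedding : ∀ {A B : Bundled.{w} permLang.Structure}, (A ↪[permLang] B) → B ∈ K → A ∈ K
  rel : ∀ A : Bundled.{w} permLang.Structure, Fin 2 → A → A → Prop
  rel_asymm : ∀ A ∈ K, ∀ i, Std.Asymm (rel A i)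
  rel_isOrderConnected : ∀ A ∈ K, ∀ i, IsOrderConnected A (rel A i)
  rel_apply_apply : ∀ {A B : Bundled.{w} permLang.Structure} (f : A ↪[permLang] B) {i x y},
    rel B i (f x) (f y) ↔ rel A i x y
  grid : ℕ → Bundled.{w} permLang.Structure
  grid_mem : ∀ N, grid N ∈ K
  point : ∀ {N}, Fin N → Fin N → grid N
  exists_embedding : ∀ {N}, ∀ A ∈ K, ∀ s : Fin 2 → A → Fin N,
    (∀ i x y, s i x < s i y ↔ rel A i x y) →
      ∃ e : A ↪[permLang] grid N, ∀ x, e x = point (s 0 x) (s 1 x)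

namespace GridCoding

variable {K : Set (Bundled.{w} permLang.Structure)} (c : GridCoding K)

/-- The two rank functions of `A`, put one after the other in a single chain. -/
noncomputable def rank (A : Bundled.{w} permLang.Structure) (z : Fin 2 × A) : Fin 2 ×ₗ ℕ :=
  toLex (z.1, {x | c.rel A z.1 x z.2}.ncard)

theorem rank_lt_rank_iff {A : Bundled.{w} permLang.Structure} (hA : A ∈ K) {z z' : Fin 2 × A} :
    c.rank A z < c.rank A z' ↔ z.1 < z'.1 ∨ z.1 = z'.1 ∧ c.rel A z.1 z.2 z'.2 := by
  have := (c.subset_allPerms hA).1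
  have := c.rel_asymm A hA z.1
  have := c.rel_isOrderConnected A hA z.1
  rw [rank, rank, Prod.Lex.toLex_lt_toLex]
  refine or_congr_right (and_congr_right fun h => ?_)
  rw [← ncard_setOf_rel_lt_iff (c.rel A z.1), ← h]

theorem exists_embedding_of_rank {A : Bundled.{w} permLang.Structure} (hA : A ∈ K) {N : ℕ}
    (s : Set.range (c.rank A) ↪o Fin N) : ∃ e : A ↪[permLang] c.grid N, ∀ x,
      e x = c.point (s (Set.rangeFactorization _ (0, x))) (s (Set.rangeFactorization _ (1, x))) :=
  c.exists_embedding A hA (fun i x => s (Set.rangeFactorization _ (i, x))) fun i x y => by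
    rw [s.lt_iff_lt, ← Subtype.coe_lt_coe]
    exact (c.rank_lt_rank_iff hA).trans (by simp)

theorem isRamseyClass (c : GridCoding K) : IsRamseyClass K := by
  intro A hA B hB r
  have := (c.subset_allPerms hA).1
  have := (c.subset_allPerms hB).1
  rcases r.eq_zero_or_pos with rfl | hr
  · exact ⟨A, hA, fun χ => (χ (Language.Embedding.refl _ _)).elim0⟩
  have : Nonempty (Fin r) := ⟨⟨0, hr⟩⟩
  obtain ⟨N, hN⟩ := exists_orderEmbedding_forall_trans_eq (Set.range (c.rank A))
    (Set.range (c.rank B)) (Fin r)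
  choose φ hφ using fun s => c.exists_embedding_of_rank hA (N := N) s
  refine ⟨c.grid N, c.grid_mem N, partitionArrow_iff.2 fun χ => ?_⟩
  obtain ⟨i, s, hs⟩ := hN fun s => χ (φ s)
  obtain ⟨e, he⟩ := c.exists_embedding_of_rank hB s
  refine ⟨i, e, fun f => ?_⟩
  obtain ⟨g, hg⟩ := exists_range_orderEmbedding (a := c.rank A) (b := c.rank B) (Prod.map id f)
    fun x y => by simp only [c.rank_lt_rank_iff hA, c.rank_lt_rank_iff hB, Prod.map_fst,
      Prod.map_snd, id_eq, c.rel_apply_apply]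
  have hef : e.comp f = φ (g.trans s) := by
    ext x
    rw [Language.Embedding.comp_apply, he, hφ]
    simp only [RelEmbedding.trans_apply, hg, Prod.map_apply, id_eq]
  rw [hef, hs]

theorem nonempty_embedding_grid {A : Bundled.{w} permLang.Structure} (hA : A ∈ K) {N : ℕ}
    (hN : Nat.card A < N) : Nonempty (A ↪[permLang] c.grid N) := by
  have := (c.subset_allPerms hA).1
  have hlt (i : Fin 2) (x : A) : {z | c.rel A i z x}.ncard < N :=
    (Set.ncard_le_card _).trans_lt hN
  refine (c.exists_embedding A hA (fun i x => ⟨_, hlt i x⟩) fun i x y => ?_).nonempty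
  have := c.rel_asymm A hA i
  have := c.rel_isOrderConnected A hA i
  exact ncard_setOf_rel_lt_iff (c.rel A i)

theorem isPermutationClass (c : GridCoding K) : IsPermutationClass K where
  subset_allPerms := c.subset_allPerms
  exists_nonempty := ⟨c.grid 1, c.grid_mem 1, ⟨c.point 0 0⟩⟩
  isoClosed := fun _ _ ⟨e⟩ hA => c.mem_of_embedding e.symm.toEmbedding hA
  hereditary := fun _ hA _ ⟨_, ⟨f⟩⟩ => c.mem_of_embedding f hA
  jointEmbedding := fun A hA B hB =>
    ⟨c.grid (max (Nat.card A) (Nat.card B) + 1), c.grid_mem _,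
      c.nonempty_embedding_grid hA (Nat.lt_succ_of_le (le_max_left _ _)),
      c.nonempty_embedding_grid hB (Nat.lt_succ_of_le (le_max_right _ _))⟩

/-- The coding of the flipped permutations. -/
def flip : GridCoding {A | flipPerm A ∈ K} where
  subset_allPerms := fun _ hA => flipPerm_mem_allPerms_iff.1 (c.subset_allPerms hA)
  mem_of_embedding := fun f hB => c.mem_of_embedding (flipEmbedding f) hB
  rel := fun A => c.rel (flipPerm A)
  rel_asymm := fun _ hA => c.rel_asymm _ hA
  rel_isOrderConnected := fun _ hA => c.rel_isOrderConnected _ hA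
  rel_apply_apply := fun f => c.rel_apply_apply (flipEmbedding f)
  grid := fun N => flipPerm (c.grid N)
  grid_mem := fun N => by
    simpa only [Set.mem_ofPred_eq, flipPerm_flipPerm] using c.grid_mem N
  point := c.point
  exists_embedding := fun {N} A hA s hs =>
    let ⟨e, he⟩ := c.exists_embedding (flipPerm A) hA s hs
    ⟨permEmbedding (M := A) (N := flipPerm (c.grid N)) e.toEmbedding fun i _ _ => match i with
      | 0 => permLt_apply_apply e
      | 1 => permLt_apply_apply e, he⟩

end GridCoding

/-- The chain of length `N` as an identity permutation. -/
def chainPerm (N : ℕ) : Bundled.{w} permLang.Structure :=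
  permOf (M := ULift.{w} (Fin N)) ULift.down ULift.down

/-- The pairs of numbers below `N`, ordered lexicographically with either coordinate first. -/
def gridPerm (N : ℕ) : Bundled.{w} permLang.Structure :=
  permOf (M := ULift.{w} (Fin N × Fin N)) (fun z => toLex z.down) (fun z => toLex z.down.swap)

theorem gridPerm_mem_allPerms (N : ℕ) : gridPerm.{w} N ∈ allPerms :=
  permOf_mem_allPerms (toLex.injective.comp ULift.down_injective)
    (toLex.injective.comp (Prod.swap_injective.comp ULift.down_injective))

/-- The increasing sequence of length `N` of decreasing sequences of length `N`. -/
def lexPerm (N : ℕ) : Bundled.{w} permLang.Structure :=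
  permOf (M := ULift.{w} (Fin N × Fin N)) (fun z => toLex z.down)
    (fun z => toLex (z.down.1, OrderDual.toDual z.down.2))

theorem permLt_zero_lexPerm {N : ℕ} {x y : lexPerm.{w} N} : permLt 0 x y ↔
    x.down.1 < y.down.1 ∨ x.down.1 = y.down.1 ∧ x.down.2 < y.down.2 :=
  Prod.Lex.toLex_lt_toLex

theorem permLt_one_lexPerm {N : ℕ} {x y : lexPerm.{w} N} : permLt 1 x y ↔
    x.down.1 < y.down.1 ∨ x.down.1 = y.down.1 ∧ y.down.2 < x.down.2 :=
  Prod.Lex.toLex_lt_toLex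

theorem permLt_zero_lexPerm_of_permLt {N : ℕ} {x y z : lexPerm.{w} N} (hxy : permLt 1 x y)
    (hyz : permLt 1 y z) (hzx : permLt 0 z x) : permLt 0 y x ∧ permLt 0 z y := by
  rw [permLt_one_lexPerm] at hxy hyz
  simp only [permLt_zero_lexPerm] at hzx ⊢
  grind

theorem lexPerm_mem_incDecPerms (N : ℕ) : lexPerm.{w} N ∈ incDecPerms := by
  refine ⟨permOf_mem_allPerms (toLex.injective.comp ULift.down_injective)
    (toLex.injective.comp ((Function.injective_id.prodMap OrderDual.toDual.injective).comp
      ULift.down_injective)), fun ⟨x, hx⟩ => ?_, fun ⟨x, hx⟩ => ?_⟩ <;>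
    obtain ⟨h₁₀, h₂₁⟩ := permLt_zero_lexPerm_of_permLt ((hx 0 1).2.2 (by decide))
      ((hx 1 2).2.2 (by decide)) ((hx 2 0).1.2 (by decide))
  · exact absurd ((hx 1 0).1.1 h₁₀) (by decide)
  · exact absurd ((hx 2 1).1.1 h₂₁) (by decide)

/-- `x` lies below `y` in both orders. In an increasing sequence of decreasing sequences, this says
that the block of `x` comes before the block of `y`. -/
def PermBelow {M : Type u} [permLang.Structure M] (x y : M) : Prop :=
  permLt 0 x y ∧ permLt 1 x y

theorem permBelow_or_permBelow {M : Type u} [permLang.Structure M] (hM : IsPermutation M)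
    (h231 : ¬ HasPattern M ![2, 3, 1]) (h312 : ¬ HasPattern M ![3, 1, 2]) {x z : M} (y : M)
    (hxz : PermBelow x z) : PermBelow x y ∨ PermBelow y z := by
  by_contra! h
  obtain ⟨hxy, hyz⟩ := h
  have hxy_ne : x ≠ y := fun h => hyz (h ▸ hxz)
  have hyz_ne : y ≠ z := fun h => hxy (h ▸ hxz)
  obtain ⟨hxz₀, hxz₁⟩ := hxz
  rcases permLt_trichotomous hM 0 x y with hxy₀ | rfl | hyx₀
  · have hyx₁ := ((permLt_trichotomous hM 1 x y).resolve_left fun h => hxy ⟨hxy₀, h⟩).resolve_left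
      hxy_ne
    have hyz₁ := permLt_trans hM hyx₁ hxz₁
    have hzy₀ := ((permLt_trichotomous hM 0 y z).resolve_left fun h => hyz ⟨h, hyz₁⟩).resolve_left
      hyz_ne
    refine h312 (hM.hasPattern (by decide) ![y, x, z] ?_ ?_) <;> intro i j hij <;>
      fin_cases i <;> fin_cases j <;> first | exact absurd hij (by decide) | assumption
  · exact hxy_ne rfl
  · have hyz₀ := permLt_trans hM hyx₀ hxz₀
    have hzy₁ := ((permLt_trichotomous hM 1 y z).resolve_left fun h => hyz ⟨hyz₀, h⟩).resolve_left
      hyz_ne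
    have hxy₁ := permLt_trans hM hxz₁ hzy₁
    refine h231 (hM.hasPattern (by decide) ![x, z, y] ?_ ?_) <;> intro i j hij <;>
      fin_cases i <;> fin_cases j <;> first | exact absurd hij (by decide) | assumption

/-- Permutations on at most one point need no coordinates. -/
def trivialPermsCoding : GridCoding trivialPerms.{w} where
  subset_allPerms := fun _ hA => hA.1
  mem_of_embedding := fun f hB =>
    have := hB.2
    ⟨mem_allPerms_of_embedding f hB.1, f.injective.subsingleton⟩
  rel := fun _ _ _ _ => False
  rel_asymm := fun _ _ _ => ⟨fun _ _ h => h.elim⟩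
  rel_isOrderConnected := fun _ _ _ => ⟨fun _ _ _ h => h.elim⟩
  rel_apply_apply := fun _ => Iff.rfl
  grid := fun _ => chainPerm 1
  grid_mem := fun _ => ⟨permOf_mem_allPerms ULift.down_injective ULift.down_injective,
    inferInstanceAs (Subsingleton (ULift (Fin 1)))⟩
  point := fun _ _ => ULift.up 0
  exists_embedding := fun _ hA _ _ =>
    ⟨hA.1.2.embedding (permOf_mem_allPerms ULift.down_injective ULift.down_injective).2
      (fun _ => ULift.up 0) fun i x y hxy =>
        have := hA.2
        absurd (Subsingleton.elim x y ▸ hxy) (permLt_irrefl hA.1.2 i _), fun _ => rfl⟩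

/-- Identity permutations are coded by the position of a point, used as either coordinate. -/
def identityPermsCoding : GridCoding identityPerms.{w} where
  subset_allPerms := fun _ hA => hA.1
  mem_of_embedding := fun f hB => ⟨mem_allPerms_of_embedding f hB.1, fun x y => by
    simpa only [permLt_apply_apply] using hB.2 (f x) (f y)⟩
  rel := fun _ _ => permLt 0
  rel_asymm := fun _ hA _ => have := hA.1.2 0; inferInstance
  rel_isOrderConnected := fun _ hA _ => have := hA.1.2 0; inferInstance
  rel_apply_apply := fun f => permLt_apply_apply f
  grid := chainPerm
  grid_mem := fun _ =>
    ⟨permOf_mem_allPerms ULift.down_injective ULift.down_injective, fun _ _ => Iff.rfl⟩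
  point := fun s _ => ULift.up s
  exists_embedding := fun _ hA s hs =>
    ⟨hA.1.2.embedding (permOf_mem_allPerms ULift.down_injective ULift.down_injective).2
      (fun x => ULift.up (s 0 x)) fun i x y => match i with
        | 0 => (hs 0 x y).2
        | 1 => fun hxy => (hs 0 x y).2 ((hA.2 x y).1 hxy), fun _ => rfl⟩

/-- Arbitrary permutations are coded by the positions of a point in the two orders. -/
def allPermsCoding : GridCoding allPerms.{w} where
  subset_allPerms := Set.Subset.rfl
  mem_of_embedding := mem_allPerms_of_embedding
  rel := fun _ => permLt
  rel_asymm := fun _ hA i => have := hA.2 i; inferInstance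
  rel_isOrderConnected := fun _ hA i => have := hA.2 i; inferInstance
  rel_apply_apply := fun f => permLt_apply_apply f
  grid := gridPerm
  grid_mem := gridPerm_mem_allPerms
  point := fun s t => ULift.up (s, t)
  exists_embedding := fun _ hA s hs =>
    ⟨hA.2.embedding (gridPerm_mem_allPerms _).2 (fun x => ULift.up (s 0 x, s 1 x))
      fun i x y hxy => match i with
        | 0 => Prod.Lex.toLex_lt_toLex.2 (Or.inl ((hs 0 x y).2 hxy))
        | 1 => Prod.Lex.toLex_lt_toLex.2 (Or.inl ((hs 1 x y).2 hxy)), fun _ => rfl⟩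

/-- Increasing sequences of decreasing sequences are coded by the block of a point and its position
in `<₀`. -/
def incDecPermsCoding : GridCoding incDecPerms.{w} where
  subset_allPerms := fun _ hA => hA.1
  mem_of_embedding := fun f hB => ⟨mem_allPerms_of_embedding f hB.1,
    fun h => hB.2.1 (h.of_embedding f), fun h => hB.2.2 (h.of_embedding f)⟩
  rel := fun _ => ![PermBelow, permLt 0]
  rel_asymm := fun _ hA i => match i with
    | 0 => ⟨fun _ _ h h' => permLt_asymm hA.1.2 h.1 h'.1⟩
    | 1 => have := hA.1.2 0; inferInstanceAs (Std.Asymm (permLt 0))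
  rel_isOrderConnected := fun A hA i => match i with
    | 0 => ⟨fun _ y _ => permBelow_or_permBelow hA.1.2 hA.2.1 hA.2.2 y⟩
    | 1 => have := hA.1.2 0; inferInstanceAs (IsOrderConnected A (permLt 0))
  rel_apply_apply := fun {_ _} f {i _ _} => match i with
    | 0 => and_congr (permLt_apply_apply f) (permLt_apply_apply f)
    | 1 => permLt_apply_apply f
  grid := lexPerm
  grid_mem := lexPerm_mem_incDecPerms
  point := fun s t => ULift.up (s, t)
  exists_embedding := fun _ hA s hs => by
    refine ⟨hA.1.2.embedding (lexPerm_mem_incDecPerms _).1.2 (fun x => ULift.up (s 0 x, s 1 x))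
      fun i x y hxy => ?_, fun _ => rfl⟩
    have hle : s 0 x ≤ s 0 y := not_lt.1 fun h =>
      permLt_asymm hA.1.2 hxy (match i with
        | 0 => ((hs 0 y x).1 h).1
        | 1 => ((hs 0 y x).1 h).2)
    match i with
    | 0 => exact permLt_zero_lexPerm.2 (hle.lt_or_eq.imp_right fun h => ⟨h, (hs 1 x y).2 hxy⟩)
    | 1 =>
      refine permLt_one_lexPerm.2 (hle.lt_or_eq.imp_right fun h => ⟨h, (hs 1 y x).2 ?_⟩)
      refine ((permLt_trichotomous hA.1.2 0 x y).resolve_left fun h₀ => ?_).resolve_left ?_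
      · exact h.not_lt ((hs 0 x y).2 ⟨h₀, hxy⟩)
      · rintro rfl
        exact permLt_irrefl hA.1.2 1 _ hxy

/-- Reversals are flipped identity permutations. -/
def reversalPermsCoding : GridCoding reversalPerms.{w} :=
  reversalPerms_eq ▸ identityPermsCoding.flip

/-- Decreasing sequences of increasing sequences are flipped increasing sequences of decreasing
sequences. -/
def decIncPermsCoding : GridCoding decIncPerms.{w} :=
  decIncPerms_eq ▸ incDecPermsCoding.flip

end Coding

section PatternMembership

theorem patPerm_mem_allPerms_iff {n : ℕ} {p : Fin n → ℕ} :
    patPerm.{w} p ∈ allPerms ↔ Function.Injective p := by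
  refine ⟨fun h i j hij => ?_, patPerm_mem_allPerms⟩
  rcases permLt_trichotomous h.2 0 ⟨i⟩ ⟨j⟩ with hlt | heq | hgt
  · exact absurd hij hlt.ne
  · exact ULift.up_injective heq
  · exact absurd hij hgt.ne'

theorem patPerm_mem_trivialPerms_iff {n : ℕ} {p : Fin n → ℕ} :
    patPerm.{w} p ∈ trivialPerms ↔ Function.Injective p ∧ ∀ i j : Fin n, i = j :=
  and_congr patPerm_mem_allPerms_iff ⟨fun h i j => ULift.up_injective (h.elim ⟨i⟩ ⟨j⟩),
    fun h => ⟨fun i j => ULift.down_injective (h i.down j.down)⟩⟩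

theorem patPerm_mem_identityPerms_iff {n : ℕ} {p : Fin n → ℕ} :
    patPerm.{w} p ∈ identityPerms ↔ Function.Injective p ∧ ∀ i j, i < j ↔ p i < p j :=
  and_congr patPerm_mem_allPerms_iff ⟨fun h i j => h ⟨i⟩ ⟨j⟩, fun h i j => h i.down j.down⟩

theorem patPerm_mem_reversalPerms_iff {n : ℕ} {p : Fin n → ℕ} :
    patPerm.{w} p ∈ reversalPerms ↔ Function.Injective p ∧ ∀ i j, i < j ↔ p j < p i :=
  and_congr patPerm_mem_allPerms_iff ⟨fun h i j => h ⟨i⟩ ⟨j⟩, fun h i j => h i.down j.down⟩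

theorem patPerm_mem_incDecPerms_iff {n : ℕ} {p : Fin n → ℕ} :
    patPerm.{w} p ∈ incDecPerms ↔ Function.Injective p ∧
      (¬ ∃ x : Fin 3 → Fin n, ∀ i j,
        (p (x i) < p (x j) ↔ ![2, 3, 1] i < ![2, 3, 1] j) ∧ (x i < x j ↔ i < j)) ∧
      ¬ ∃ x : Fin 3 → Fin n, ∀ i j,
        (p (x i) < p (x j) ↔ ![3, 1, 2] i < ![3, 1, 2] j) ∧ (x i < x j ↔ i < j) :=
  and_congr patPerm_mem_allPerms_iff
    (and_congr hasPattern_patPerm_iff.not hasPattern_patPerm_iff.not)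

theorem patPerm_mem_decIncPerms_iff {n : ℕ} {p : Fin n → ℕ} :
    patPerm.{w} p ∈ decIncPerms ↔ Function.Injective p ∧
      (¬ ∃ x : Fin 3 → Fin n, ∀ i j,
        (p (x i) < p (x j) ↔ ![2, 1, 3] i < ![2, 1, 3] j) ∧ (x i < x j ↔ i < j)) ∧
      ¬ ∃ x : Fin 3 → Fin n, ∀ i j,
        (p (x i) < p (x j) ↔ ![1, 3, 2] i < ![1, 3, 2] j) ∧ (x i < x j ↔ i < j) :=
  and_congr patPerm_mem_allPerms_iff
    (and_congr hasPattern_patPerm_iff.not hasPattern_patPerm_iff.not)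

end PatternMembership

section Separation

/-- Under `f`, some third index lies strictly between `a` and `b`. -/
abbrev IsSeparated {ι α : Type*} [LT α] (f : ι → α) (a b : ι) : Prop :=
  ∃ c, f a < f c ∧ f c < f b ∨ f b < f c ∧ f c < f a

theorem forall_iff_of_forall_ne_pair {ι : Type*} {R S : ι → ι → Prop} {a b : ι}
    (h : ∀ i j, s(i, j) ≠ s(a, b) → (R i j ↔ S i j)) (hab : R a b ↔ S a b) (hba : R b a ↔ S b a)
    (i j : ι) : R i j ↔ S i j := by
  by_cases hij : s(i, j) = s(a, b)
  · rcases Sym2.eq_iff.1 hij with ⟨rfl, rfl⟩ | ⟨rfl, rfl⟩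
    exacts [hab, hba]
  · exact h i j hij

theorem IsSeparated.lt_or_gt {ι α : Type*} [Preorder α] {f : ι → α} {a b : ι}
    (hab : IsSeparated f a b) : f a < f b ∨ f b < f a :=
  let ⟨_, hc⟩ := hab
  hc.imp (fun h => h.1.trans h.2) (fun h => h.1.trans h.2)

theorem IsSeparated.ne {ι α : Type*} [Preorder α] {f : ι → α} {a b : ι}
    (hab : IsSeparated f a b) : a ≠ b := by
  rintro rfl
  exact hab.lt_or_gt.elim (lt_irrefl _) (lt_irrefl _)

theorem IsSeparated.map_ne {ι α δ : Type*} [Preorder α] {f : ι → α} {a b : ι}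
    (hab : IsSeparated f a b) {r : δ → δ → Prop} [Std.Irrefl r] {h : ι → δ}
    (hh : ∀ i j, r (h i) (h j) ↔ f i < f j) : h a ≠ h b := fun heq =>
  hab.lt_or_gt.elim (fun hlt => irrefl_of r (h b) (heq ▸ (hh a b).2 hlt))
    (fun hgt => irrefl_of r (h b) (heq ▸ (hh b a).2 hgt))

theorem IsSeparated.rel_iff_lt {ι α δ : Type*} [Preorder α] {f : ι → α} {a b : ι}
    (hab : IsSeparated f a b) {r : δ → δ → Prop} [IsStrictOrder δ r] {h : ι → δ}
    (hh : ∀ i j, s(i, j) ≠ s(a, b) → (r (h i) (h j) ↔ f i < f j)) :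
    ∀ i j, r (h i) (h j) ↔ f i < f j := by
  obtain ⟨c, hc⟩ := hab
  wlog hacb : f a < f c ∧ f c < f b generalizing a b
  · exact this (by simpa only [Sym2.eq_swap] using hh) hc.symm (hc.resolve_left hacb)
  have hac : r (h a) (h c) := (hh a c fun h => hacb.2.ne (by grind)).2 hacb.1
  have hcb : r (h c) (h b) := (hh c b fun h => hacb.1.ne (by grind)).2 hacb.2
  have hab : r (h a) (h b) := _root_.trans hac hcb
  have hlt : f a < f b := hacb.1.trans hacb.2
  exact forall_iff_of_forall_ne_pair hh (iff_of_true hab hlt)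
    (iff_of_false (asymm_of r hab) hlt.asymm)

/-- The patterns that can be minimal among those missing from an amalgamation class. -/
inductive IsMinimalPattern : ∀ {n : ℕ}, (Fin n → ℕ) → Prop
  | p12 : IsMinimalPattern ![1, 2]
  | p21 : IsMinimalPattern ![2, 1]
  | p132 : IsMinimalPattern ![1, 3, 2]
  | p213 : IsMinimalPattern ![2, 1, 3]
  | p231 : IsMinimalPattern ![2, 3, 1]
  | p312 : IsMinimalPattern ![3, 1, 2]
  | p2413 : IsMinimalPattern ![2, 4, 1, 3]
  | p3142 : IsMinimalPattern ![3, 1, 4, 2]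

theorem exists_isSeparated_of_five_le {n : ℕ} (hn : 5 ≤ n) {p : Fin n → ℕ}
    (hp : Function.Injective p) : ∃ a b, IsSeparated id a b ∧ IsSeparated p a b := by
  let x : Fin 5 → Fin n := Fin.castLE hn
  have hx : StrictMono x := Fin.strictMono_castLE hn
  have hpos : ∀ i j k : Fin 5, i < k ∧ k < j → IsSeparated id (x i) (x j) :=
    fun _ _ _ h => ⟨_, .inl ⟨hx h.1, hx h.2⟩⟩
  have hne : ∀ i j, i ≠ j → p (x i) ≠ p (x j) := fun i j => (hp.comp hx.injective).ne
  have h02 := hne 0 2 (by decide)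
  have h04 := hne 0 4 (by decide)
  have h24 := hne 2 4 (by decide)
  -- Positions `0`, `2`, `4` are pairwise separated; one of their values separates the other two.
  have hval : IsSeparated p (x 0) (x 2) ∨ IsSeparated p (x 0) (x 4) ∨
      IsSeparated p (x 2) (x 4) := by
    have hmed : (p (x 0) < p (x 4) ∧ p (x 4) < p (x 2) ∨ p (x 2) < p (x 4) ∧ p (x 4) < p (x 0)) ∨
        (p (x 0) < p (x 2) ∧ p (x 2) < p (x 4) ∨ p (x 4) < p (x 2) ∧ p (x 2) < p (x 0)) ∨
        (p (x 2) < p (x 0) ∧ p (x 0) < p (x 4) ∨ p (x 4) < p (x 0) ∧ p (x 0) < p (x 2)) := by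
      omega
    exact hmed.imp (⟨_, ·⟩) (Or.imp (⟨_, ·⟩) (⟨_, ·⟩))
  rcases hval with h | h | h
  · exact ⟨_, _, hpos 0 2 1 (by decide), h⟩
  · exact ⟨_, _, hpos 0 4 1 (by decide), h⟩
  · exact ⟨_, _, hpos 2 4 3 (by decide), h⟩

theorem exists_isMinimalPattern_of_not_isSeparated_four {p : Fin 4 → ℕ}
    (hp : Function.Injective p) (hsep : ∀ a b, IsSeparated id a b → ¬ IsSeparated p a b) :
    ∃ q : Fin 4 → ℕ, IsMinimalPattern q ∧ ∀ i j, p i < p j ↔ q i < q j := by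
  have hne : ∀ i j, i ≠ j → p i ≠ p j := fun _ _ => hp.ne
  have hno : ∀ i j c, IsSeparated id i j → ¬ (p i < p c ∧ p c < p j ∨ p j < p c ∧ p c < p i) :=
    fun i j c hij h => hsep i j hij ⟨c, h⟩
  have h02 := hne 0 2 (by decide)
  have h13 := hne 1 3 (by decide)
  have h01 := hne 0 1 (by decide)
  have h03 := hne 0 3 (by decide)
  have h12 := hne 1 2 (by decide)
  have h23 := hne 2 3 (by decide)
  have h021 := hno 0 2 1 (by decide)
  have h023 := hno 0 2 3 (by decide)
  have h031 := hno 0 3 1 (by decide)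
  have h032 := hno 0 3 2 (by decide)
  have h130 := hno 1 3 0 (by decide)
  have h132 := hno 1 3 2 (by decide)
  rcases lt_or_gt_of_ne h02 with h | h
  on_goal 1 => refine ⟨_, .p3142, fun i j => ?_⟩
  on_goal 2 => refine ⟨_, .p2413, fun i j => ?_⟩
  all_goals fin_cases i <;> fin_cases j <;>
    simp only [Fin.mk_zero, Fin.mk_one, Fin.reduceFinMk, Matrix.cons_val] <;> omega

theorem exists_isMinimalPattern_of_not_isSeparated {n : ℕ} (hn : 2 ≤ n) {p : Fin n → ℕ}
    (hp : Function.Injective p) (hsep : ∀ a b, IsSeparated id a b → ¬ IsSeparated p a b) :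
    ∃ q : Fin n → ℕ, IsMinimalPattern q ∧ ∀ i j, p i < p j ↔ q i < q j := by
  have hn5 : n < 5 := lt_of_not_ge fun hn5 =>
    let ⟨a, b, hab, hab'⟩ := exists_isSeparated_of_five_le hn5 hp
    hsep a b hab hab'
  have hne : ∀ i j, i ≠ j → p i ≠ p j := fun _ _ => hp.ne
  have hno : ∀ i j c, IsSeparated id i j → ¬ (p i < p c ∧ p c < p j ∨ p j < p c ∧ p c < p i) :=
    fun i j c hij h => hsep i j hij ⟨c, h⟩
  interval_cases n
  · have h01 := hne 0 1 (by decide)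
    rcases lt_or_gt_of_ne h01 with h | h
    on_goal 1 => refine ⟨_, .p12, fun i j => ?_⟩
    on_goal 2 => refine ⟨_, .p21, fun i j => ?_⟩
    all_goals fin_cases i <;> fin_cases j <;>
      simp only [Fin.mk_zero, Fin.mk_one, Matrix.cons_val] <;> omega
  · have h01 := hne 0 1 (by decide)
    have h02 := hne 0 2 (by decide)
    have h12 := hne 1 2 (by decide)
    have h021 := hno 0 2 1 (by decide)
    rcases lt_or_gt_of_ne h01 with h | h <;> rcases lt_or_gt_of_ne h02 with h' | h'
    on_goal 1 => refine ⟨_, .p132, fun i j => ?_⟩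
    on_goal 2 => refine ⟨_, .p231, fun i j => ?_⟩
    on_goal 3 => refine ⟨_, .p213, fun i j => ?_⟩
    on_goal 4 => refine ⟨_, .p312, fun i j => ?_⟩
    all_goals fin_cases i <;> fin_cases j <;>
      simp only [Fin.mk_zero, Fin.mk_one, Fin.reduceFinMk, Matrix.cons_val] <;> omega
  · exact exists_isMinimalPattern_of_not_isSeparated_four hp hsep

end Separation

section AmalgamationClasses

open FirstOrder.Language

variable {K K' : Set (Bundled.{w} permLang.Structure)}

theorem IsPermutationClass.mem_of_embedding (hK : IsPermutationClass K)
    {A B : Bundled.{w} permLang.Structure} (f : A ↪[permLang] B) (hB : B ∈ K) : A ∈ K :=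
  have := (mem_allPerms_of_embedding f (hK.subset_allPerms hB)).1
  hK.hereditary B hB ⟨Structure.FG.of_finite, ⟨f⟩⟩

theorem IsPermutationClass.patPerm_mem_of_hasPattern (hK : IsPermutationClass K)
    {A : Bundled.{w} permLang.Structure} (hA : A ∈ K) {n : ℕ} {p : Fin n → ℕ}
    (hp : HasPattern A p) : patPerm p ∈ K :=
  let ⟨f⟩ := hp.nonempty_embedding
  hK.mem_of_embedding f hA

theorem IsPermutationClass.patPerm_mem_of_comp (hK : IsPermutationClass K) {m n : ℕ}
    {p : Fin m → ℕ} {q : Fin n → ℕ} (hq : patPerm q ∈ K) (x : Fin m → Fin n)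
    (hx : ∀ i j, (q (x i) < q (x j) ↔ p i < p j) ∧ (x i < x j ↔ i < j)) : patPerm p ∈ K :=
  hK.patPerm_mem_of_hasPattern hq (hasPattern_patPerm_iff.2 ⟨x, hx⟩)

theorem IsPermutationClass.mem_of_subsingleton (hK : IsPermutationClass K)
    {A : Bundled.{w} permLang.Structure} (hA : A ∈ allPerms) [Subsingleton A] : A ∈ K := by
  obtain ⟨B, hB, ⟨b⟩⟩ := hK.exists_nonempty
  exact hK.mem_of_embedding (hA.2.embedding (hK.subset_allPerms hB).2 (fun _ => b)
    fun i x y hxy => absurd hxy (Subsingleton.elim x y ▸ permLt_irrefl hA.2 i x)) hB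

/-- A class of finite permutations with the amalgamation property. -/
structure IsAmalgamationClass (K : Set (Bundled.{w} permLang.Structure)) : Prop extends
    IsPermutationClass K where
  amalgamation : Amalgamation K

/-- The subpermutation of `patPerm p` on the points with positions in `s`. -/
def patPermOn {n : ℕ} (p : Fin n → ℕ) (s : Set (Fin n)) : Bundled.{w} permLang.Structure :=
  permOf (M := ULift.{w} s) (fun i => p i.down) (fun i => i.down.1)

/-- The inclusion of the subpermutation on `s` into the subpermutation on `t`. -/
def patPermOnInclusion {n : ℕ} (p : Fin n → ℕ) {s t : Set (Fin n)} (hst : s ⊆ t) :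
    patPermOn.{w} p s ↪[permLang] patPermOn.{w} p t :=
  permEmbedding (M := patPermOn p s) (N := patPermOn p t)
    ⟨fun i => ⟨Set.inclusion hst i.down⟩,
      ULift.up_injective.comp ((Set.inclusion_injective hst).comp ULift.down_injective)⟩
    fun i _ _ => match i with
      | 0 => Iff.rfl
      | 1 => Iff.rfl

theorem IsPermutationClass.patPermOn_compl_singleton_mem (hK : IsPermutationClass K) {n : ℕ}
    {p : Fin (n + 1) → ℕ} {c : Fin (n + 1)} (hc : patPerm (p ∘ c.succAbove) ∈ K) :
    patPermOn p {c}ᶜ ∈ K := by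
  let e : ({c}ᶜ : Set (Fin (n + 1))) ≃o Fin n := (finSuccAboveOrderIso c).symm
  have he : ∀ i, c.succAbove (e i) = i := fun i =>
    congrArg Subtype.val ((finSuccAboveOrderIso c).apply_symm_apply i)
  refine hK.mem_of_embedding (permEmbedding (M := patPermOn p {c}ᶜ) (N := patPerm (p ∘ c.succAbove))
    ((Equiv.ulift.trans e.toEquiv).trans Equiv.ulift.symm).toEmbedding fun i x y => ?_) hc
  match i with
  | 0 => exact Iff.of_eq (congrArg₂ (p · < p ·) (he x.down) (he y.down))
  | 1 => exact e.lt_iff_lt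

namespace IsAmalgamationClass

theorem exists_amalgam_patPerm (hK : IsAmalgamationClass K) {n : ℕ} {p : Fin (n + 1) → ℕ}
    {a b : Fin (n + 1)} (hab : a ≠ b) (ha : patPerm (p ∘ a.succAbove) ∈ K)
    (hb : patPerm (p ∘ b.succAbove) ∈ K) :
    ∃ D ∈ K, ∃ h : Fin (n + 1) → D, ∀ i j, s(i, j) ≠ s(a, b) →
      (permLt 0 (h i) (h j) ↔ p i < p j) ∧ (permLt 1 (h i) (h j) ↔ i < j) := by
  classical
  have ha' := hK.patPermOn_compl_singleton_mem ha
  let f := patPermOnInclusion p (Set.inter_subset_left (s := {a}ᶜ) (t := {b}ᶜ))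
  let g := patPermOnInclusion p (Set.inter_subset_right (s := {a}ᶜ) (t := {b}ᶜ))
  obtain ⟨D, f', g', hD, hfg⟩ := hK.amalgamation _ _ _ f g (hK.mem_of_embedding f ha') ha'
    (hK.patPermOn_compl_singleton_mem hb)
  let h : Fin (n + 1) → D := fun i => if hi : i = a then g' ⟨a, hab⟩ else f' ⟨i, hi⟩
  have h_of_ne_a : ∀ i (hi : i ≠ a), h i = f' ⟨i, hi⟩ := fun i hi => dif_neg hi
  have h_of_ne_b : ∀ i (hi : i ≠ b), h i = g' ⟨i, hi⟩ := fun i hi => by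
    by_cases hia : i = a
    · subst hia
      exact dif_pos rfl
    · exact (h_of_ne_a i hia).trans (DFunLike.congr_fun hfg ⟨i, hia, hi⟩)
  refine ⟨D, hD, h, fun i j hij => ?_⟩
  have hcases : i ≠ a ∧ j ≠ a ∨ i ≠ b ∧ j ≠ b := by grind
  rcases hcases with ⟨hi, hj⟩ | ⟨hi, hj⟩
  · rw [h_of_ne_a i hi, h_of_ne_a j hj]
    exact ⟨permLt_apply_apply f', permLt_apply_apply f'⟩
  · rw [h_of_ne_b i hi, h_of_ne_b j hj]
    exact ⟨permLt_apply_apply g', permLt_apply_apply g'⟩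

theorem patPerm_mem_of_isSeparated (hK : IsAmalgamationClass K) {n : ℕ} {p : Fin (n + 1) → ℕ}
    {a b : Fin (n + 1)} (ha : patPerm (p ∘ a.succAbove) ∈ K) (hb : patPerm (p ∘ b.succAbove) ∈ K)
    (h₀ : IsSeparated p a b) (h₁ : IsSeparated id a b) : patPerm p ∈ K := by
  obtain ⟨D, hD, h, hh⟩ := hK.exists_amalgam_patPerm h₀.ne ha hb
  have hDp := (hK.subset_allPerms hD).2
  have := hDp 0
  have := hDp 1
  have hh₀ := h₀.rel_iff_lt fun i j hij => (hh i j hij).1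
  have hh₁ := h₁.rel_iff_lt fun i j hij => (hh i j hij).2
  exact hK.patPerm_mem_of_hasPattern hD ⟨h, fun i j => ⟨hh₀ i j, hh₁ i j⟩⟩

theorem patPerm_mem_or_of_isSeparated_id (hK : IsAmalgamationClass K) {n : ℕ}
    {p p' : Fin (n + 1) → ℕ} {a b : Fin (n + 1)} (ha : patPerm (p ∘ a.succAbove) ∈ K)
    (hb : patPerm (p ∘ b.succAbove) ∈ K) (hsep : IsSeparated id a b) (hp : p a < p b)
    (hp' : p' b < p' a) (hpp' : ∀ i j, s(i, j) ≠ s(a, b) → (p i < p j ↔ p' i < p' j)) :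
    patPerm p ∈ K ∨ patPerm p' ∈ K := by
  obtain ⟨D, hD, h, hh⟩ := hK.exists_amalgam_patPerm hsep.ne ha hb
  have hDp := (hK.subset_allPerms hD).2
  have := hDp 1
  have hh₁ := hsep.rel_iff_lt fun i j hij => (hh i j hij).2
  rcases permLt_trichotomous hDp 0 (h a) (h b) with hlt | heq | hgt
  · have hh₀ := forall_iff_of_forall_ne_pair (fun i j hij => (hh i j hij).1)
      (iff_of_true hlt hp) (iff_of_false (permLt_asymm hDp hlt) hp.asymm)
    exact .inl (hK.patPerm_mem_of_hasPattern hD ⟨h, fun i j => ⟨hh₀ i j, hh₁ i j⟩⟩)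
  · exact absurd heq (hsep.map_ne hh₁)
  · have hh₀ := forall_iff_of_forall_ne_pair
      (fun i j hij => (hh i j hij).1.trans (hpp' i j hij))
      (iff_of_false (permLt_asymm hDp hgt) hp'.asymm) (iff_of_true hgt hp')
    exact .inr (hK.patPerm_mem_of_hasPattern hD ⟨h, fun i j => ⟨hh₀ i j, hh₁ i j⟩⟩)

theorem patPerm_mem_or_of_isSeparated (hK : IsAmalgamationClass K) {n : ℕ}
    {p : Fin (n + 1) → ℕ} {a b : Fin (n + 1)} (ha : patPerm (p ∘ a.succAbove) ∈ K)
    (hb : patPerm (p ∘ b.succAbove) ∈ K) (hsep : IsSeparated p a b) (hab : (a : ℕ) + 1 = b) :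
    patPerm p ∈ K ∨ patPerm (p ∘ Equiv.swap a b) ∈ K := by
  obtain ⟨D, hD, h, hh⟩ := hK.exists_amalgam_patPerm hsep.ne ha hb
  have hDp := (hK.subset_allPerms hD).2
  have := hDp 0
  have hh₀ := hsep.rel_iff_lt fun i j hij => (hh i j hij).1
  have hlt_ab : a < b := by lia
  rcases permLt_trichotomous hDp 1 (h a) (h b) with hlt | heq | hgt
  · have hh₁ := forall_iff_of_forall_ne_pair (fun i j hij => (hh i j hij).2)
      (iff_of_true hlt hlt_ab) (iff_of_false (permLt_asymm hDp hlt) hlt_ab.asymm)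
    exact .inl (hK.patPerm_mem_of_hasPattern hD ⟨h, fun i j => ⟨hh₀ i j, hh₁ i j⟩⟩)
  · exact absurd heq (hsep.map_ne hh₀)
  · have hh₁ : ∀ i j, permLt 1 (h (Equiv.swap a b i)) (h (Equiv.swap a b j)) ↔ i < j := by
      refine forall_iff_of_forall_ne_pair (a := a) (b := b) (fun i j hij => ?_) ?_ ?_
      · have hswap : s(Equiv.swap a b i, Equiv.swap a b j) ≠ s(a, b) := by grind
        refine (hh _ _ hswap).2.trans ?_
        simp only [Equiv.swap_apply_def]
        grind
      · simpa only [Equiv.swap_apply_left, Equiv.swap_apply_right] using iff_of_true hgt hlt_ab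
      · simpa only [Equiv.swap_apply_left, Equiv.swap_apply_right] using
          iff_of_false (permLt_asymm hDp hgt) hlt_ab.asymm
    exact .inr (hK.patPerm_mem_of_hasPattern hD ⟨h ∘ Equiv.swap a b, fun i j =>
      ⟨hh₀ _ _, hh₁ i j⟩⟩)

theorem mem_213_or_mem_312 (hK : IsAmalgamationClass K) (h12 : patPerm ![1, 2] ∈ K)
    (h21 : patPerm ![2, 1] ∈ K) : patPerm ![2, 1, 3] ∈ K ∨ patPerm ![3, 1, 2] ∈ K :=
  hK.patPerm_mem_or_of_isSeparated_id (a := 0) (b := 2)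
    (hK.patPerm_mem_of_comp h12 id (by decide)) (hK.patPerm_mem_of_comp h21 id (by decide))
    (by decide) (by decide) (by decide) (by decide)

theorem mem_132_or_mem_231 (hK : IsAmalgamationClass K) (h12 : patPerm ![1, 2] ∈ K)
    (h21 : patPerm ![2, 1] ∈ K) : patPerm ![1, 3, 2] ∈ K ∨ patPerm ![2, 3, 1] ∈ K :=
  hK.patPerm_mem_or_of_isSeparated_id (a := 0) (b := 2)
    (hK.patPerm_mem_of_comp h21 id (by decide)) (hK.patPerm_mem_of_comp h12 id (by decide))
    (by decide) (by decide) (by decide) (by decide)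

theorem mem_213_or_mem_231 (hK : IsAmalgamationClass K) (h12 : patPerm ![1, 2] ∈ K)
    (h21 : patPerm ![2, 1] ∈ K) : patPerm ![2, 1, 3] ∈ K ∨ patPerm ![2, 3, 1] ∈ K := by
  have h := hK.patPerm_mem_or_of_isSeparated (p := ![2, 1, 3]) (a := 1) (b := 2)
    (hK.patPerm_mem_of_comp h12 id (by decide)) (hK.patPerm_mem_of_comp h21 id (by decide))
    (by decide) rfl
  have hp : ![2, 1, 3] ∘ Equiv.swap 1 2 = ![2, 3, 1] := by decide
  rwa [hp] at h

theorem mem_132_or_mem_312 (hK : IsAmalgamationClass K) (h12 : patPerm ![1, 2] ∈ K)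
    (h21 : patPerm ![2, 1] ∈ K) : patPerm ![1, 3, 2] ∈ K ∨ patPerm ![3, 1, 2] ∈ K := by
  have h := hK.patPerm_mem_or_of_isSeparated (p := ![1, 3, 2]) (a := 0) (b := 1)
    (hK.patPerm_mem_of_comp h21 id (by decide)) (hK.patPerm_mem_of_comp h12 id (by decide))
    (by decide) rfl
  have hp : ![1, 3, 2] ∘ Equiv.swap 0 1 = ![3, 1, 2] := by decide
  rwa [hp] at h

theorem patPerm_mem_of_isSeparated_of_comp (hK : IsAmalgamationClass K) {n : ℕ}
    {p : Fin (n + 1) → ℕ} {q r : Fin n → ℕ} (a b : Fin (n + 1)) (hqK : patPerm q ∈ K)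
    (hrK : patPerm r ∈ K) (hq : ∀ i j, q i < q j ↔ p (a.succAbove i) < p (a.succAbove j))
    (hr : ∀ i j, r i < r j ↔ p (b.succAbove i) < p (b.succAbove j)) (h₀ : IsSeparated p a b)
    (h₁ : IsSeparated id a b) : patPerm p ∈ K :=
  hK.patPerm_mem_of_isSeparated (patPerm_congr hq ▸ hqK) (patPerm_congr hr ▸ hrK) h₀ h₁

theorem mem_31524 (hK : IsAmalgamationClass K) (h132 : patPerm ![1, 3, 2] ∈ K)
    (h213 : patPerm ![2, 1, 3] ∈ K) (h312 : patPerm ![3, 1, 2] ∈ K) :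
    patPerm ![3, 1, 5, 2, 4] ∈ K := by
  have h3124 : patPerm ![3, 1, 2, 4] ∈ K := hK.patPerm_mem_of_isSeparated_of_comp 1 3 h213 h312
    (by decide) (by decide) (by decide) (by decide)
  have h1423 : patPerm ![1, 4, 2, 3] ∈ K := hK.patPerm_mem_of_isSeparated_of_comp 0 3 h312 h132
    (by decide) (by decide) (by decide) (by decide)
  exact hK.patPerm_mem_of_isSeparated_of_comp 0 2 h1423 h3124
    (by decide) (by decide) (by decide) (by decide)

theorem mem_42513 (hK : IsAmalgamationClass K) (h213 : patPerm ![2, 1, 3] ∈ K)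
    (h231 : patPerm ![2, 3, 1] ∈ K) (h312 : patPerm ![3, 1, 2] ∈ K) :
    patPerm ![4, 2, 5, 1, 3] ∈ K := by
  have h4213 : patPerm ![4, 2, 1, 3] ∈ K := hK.patPerm_mem_of_isSeparated_of_comp 0 2 h213 h312
    (by decide) (by decide) (by decide) (by decide)
  have h3241 : patPerm ![3, 2, 4, 1] ∈ K := hK.patPerm_mem_of_isSeparated_of_comp 0 3 h231 h213
    (by decide) (by decide) (by decide) (by decide)
  exact hK.patPerm_mem_of_isSeparated_of_comp 2 4 h4213 h3241
    (by decide) (by decide) (by decide) (by decide)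

theorem mem_24153 (hK : IsAmalgamationClass K) (h132 : patPerm ![1, 3, 2] ∈ K)
    (h213 : patPerm ![2, 1, 3] ∈ K) (h231 : patPerm ![2, 3, 1] ∈ K) :
    patPerm ![2, 4, 1, 5, 3] ∈ K := by
  have h2314 : patPerm ![2, 3, 1, 4] ∈ K := hK.patPerm_mem_of_isSeparated_of_comp 0 3 h213 h231
    (by decide) (by decide) (by decide) (by decide)
  have h1342 : patPerm ![1, 3, 4, 2] ∈ K := hK.patPerm_mem_of_isSeparated_of_comp 0 2 h231 h132
    (by decide) (by decide) (by decide) (by decide)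
  exact hK.patPerm_mem_of_isSeparated_of_comp 2 4 h1342 h2314
    (by decide) (by decide) (by decide) (by decide)

theorem mem_35142 (hK : IsAmalgamationClass K) (h132 : patPerm ![1, 3, 2] ∈ K)
    (h231 : patPerm ![2, 3, 1] ∈ K) (h312 : patPerm ![3, 1, 2] ∈ K) :
    patPerm ![3, 5, 1, 4, 2] ∈ K := by
  have h4132 : patPerm ![4, 1, 3, 2] ∈ K := hK.patPerm_mem_of_isSeparated_of_comp 0 3 h132 h312
    (by decide) (by decide) (by decide) (by decide)
  have h2431 : patPerm ![2, 4, 3, 1] ∈ K := hK.patPerm_mem_of_isSeparated_of_comp 1 3 h231 h132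
    (by decide) (by decide) (by decide) (by decide)
  exact hK.patPerm_mem_of_isSeparated_of_comp 0 2 h4132 h2431
    (by decide) (by decide) (by decide) (by decide)

theorem mem_132_of_mem_213 (hK : IsAmalgamationClass K) (h213 : patPerm ![2, 1, 3] ∈ K) :
    patPerm ![1, 3, 2] ∈ K := by
  have h12 : patPerm ![1, 2] ∈ K := hK.patPerm_mem_of_comp h213 ![0, 2] (by decide)
  have h21 : patPerm ![2, 1] ∈ K := hK.patPerm_mem_of_comp h213 ![0, 1] (by decide)
  rcases hK.mem_132_or_mem_231 h12 h21 with h132 | h231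
  · exact h132
  rcases hK.mem_132_or_mem_312 h12 h21 with h132 | h312
  · exact h132
  exact hK.patPerm_mem_of_comp (hK.mem_42513 h213 h231 h312) ![1, 2, 4] (by decide)

theorem mem_213_of_mem_132 (hK : IsAmalgamationClass K) (h132 : patPerm ![1, 3, 2] ∈ K) :
    patPerm ![2, 1, 3] ∈ K := by
  have h12 : patPerm ![1, 2] ∈ K := hK.patPerm_mem_of_comp h132 ![0, 1] (by decide)
  have h21 : patPerm ![2, 1] ∈ K := hK.patPerm_mem_of_comp h132 ![1, 2] (by decide)
  rcases hK.mem_213_or_mem_231 h12 h21 with h213 | h231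
  · exact h213
  rcases hK.mem_213_or_mem_312 h12 h21 with h213 | h312
  · exact h213
  exact hK.patPerm_mem_of_comp (hK.mem_35142 h132 h231 h312) ![0, 2, 3] (by decide)

theorem mem_312_of_mem_231 (hK : IsAmalgamationClass K) (h231 : patPerm ![2, 3, 1] ∈ K) :
    patPerm ![3, 1, 2] ∈ K := by
  have h12 : patPerm ![1, 2] ∈ K := hK.patPerm_mem_of_comp h231 ![0, 1] (by decide)
  have h21 : patPerm ![2, 1] ∈ K := hK.patPerm_mem_of_comp h231 ![1, 2] (by decide)
  rcases hK.mem_213_or_mem_312 h12 h21 with h213 | h312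
  · have h132 := hK.mem_132_of_mem_213 h213
    exact hK.patPerm_mem_of_comp (hK.mem_24153 h132 h213 h231) ![1, 2, 4] (by decide)
  · exact h312

theorem mem_231_of_mem_312 (hK : IsAmalgamationClass K) (h312 : patPerm ![3, 1, 2] ∈ K) :
    patPerm ![2, 3, 1] ∈ K := by
  have h12 : patPerm ![1, 2] ∈ K := hK.patPerm_mem_of_comp h312 ![1, 2] (by decide)
  have h21 : patPerm ![2, 1] ∈ K := hK.patPerm_mem_of_comp h312 ![0, 1] (by decide)
  rcases hK.mem_213_or_mem_231 h12 h21 with h213 | h231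
  · have h132 := hK.mem_132_of_mem_213 h213
    exact hK.patPerm_mem_of_comp (hK.mem_31524 h132 h213 h312) ![0, 2, 3] (by decide)
  · exact h231

theorem mem_2413_iff (hK : IsAmalgamationClass K) :
    patPerm ![2, 4, 1, 3] ∈ K ↔ patPerm ![2, 1, 3] ∈ K ∧ patPerm ![2, 3, 1] ∈ K :=
  ⟨fun h => ⟨hK.patPerm_mem_of_comp h ![0, 2, 3] (by decide),
      hK.patPerm_mem_of_comp h ![0, 1, 2] (by decide)⟩,
    fun ⟨h213, h231⟩ => hK.patPerm_mem_of_comp (hK.mem_31524 (hK.mem_132_of_mem_213 h213) h213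
      (hK.mem_312_of_mem_231 h231)) ![0, 2, 3, 4] (by decide)⟩

theorem mem_3142_iff (hK : IsAmalgamationClass K) :
    patPerm ![3, 1, 4, 2] ∈ K ↔ patPerm ![2, 1, 3] ∈ K ∧ patPerm ![2, 3, 1] ∈ K :=
  ⟨fun h => ⟨hK.patPerm_mem_of_comp h ![0, 1, 2] (by decide),
      hK.patPerm_mem_of_comp h ![0, 2, 3] (by decide)⟩,
    fun ⟨h213, h231⟩ => hK.patPerm_mem_of_comp (hK.mem_42513 h213 h231
      (hK.mem_312_of_mem_231 h231)) ![0, 1, 2, 4] (by decide)⟩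

theorem exists_isMinimalPattern (hK : IsAmalgamationClass K) {n : ℕ} {p : Fin n → ℕ}
    (hp : Function.Injective p) (hpK : patPerm p ∉ K) :
    ∃ (m : ℕ) (q : Fin m → ℕ), IsMinimalPattern q ∧ HasPattern (patPerm.{w} p) q ∧
      patPerm q ∉ K := by
  induction n with
  | zero =>
    have : Subsingleton (patPerm.{w} p) := ULift.down_injective.subsingleton
    exact absurd (hK.mem_of_subsingleton (patPerm_mem_allPerms hp)) hpK
  | succ n ih =>
  by_cases hdel : ∃ c : Fin (n + 1), patPerm (p ∘ c.succAbove) ∉ K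
  · obtain ⟨c, hc⟩ := hdel
    obtain ⟨m, q, hq, hpq, hqK⟩ := ih (hp.comp c.succAbove_right_injective) hc
    obtain ⟨x, hx⟩ := hasPattern_patPerm_iff.1 hpq
    exact ⟨m, q, hq, hasPattern_patPerm_iff.2 ⟨c.succAbove ∘ x, fun i j =>
      ⟨(hx i j).1, c.succAbove_lt_succAbove_iff.trans (hx i j).2⟩⟩, hqK⟩
  push Not at hdel
  have hsep : ∀ a b, IsSeparated id a b → ¬ IsSeparated p a b := fun a b h₁ h₀ =>
    hpK (hK.patPerm_mem_of_isSeparated (hdel a) (hdel b) h₀ h₁)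
  have hn : 2 ≤ n + 1 := by
    by_contra! hn
    have : Subsingleton (Fin (n + 1)) := Fin.subsingleton_iff_le_one.2 (by lia)
    have : Subsingleton (patPerm.{w} p) := ULift.down_injective.subsingleton
    exact hpK (hK.mem_of_subsingleton (patPerm_mem_allPerms hp))
  obtain ⟨q, hq, hpq⟩ := exists_isMinimalPattern_of_not_isSeparated hn hp hsep
  exact ⟨n + 1, q, hq, hasPattern_patPerm_iff.2 ⟨id, fun i j => ⟨hpq i j, Iff.rfl⟩⟩,
    patPerm_congr hpq ▸ hpK⟩

theorem subset_of_forall_isMinimalPattern (hK : IsPermutationClass K) (hK' : IsAmalgamationClass K')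
    (h : ∀ {n : ℕ} {q : Fin n → ℕ}, IsMinimalPattern q → patPerm q ∈ K → patPerm q ∈ K') :
    K ⊆ K' := by
  intro A hA
  have hA' := hK.subset_allPerms hA
  obtain ⟨σ, ⟨e⟩⟩ := exists_perm_equiv_patPerm hA'
  refine hK'.mem_of_embedding e.symm.toEmbedding (by_contra fun hσ => ?_)
  obtain ⟨m, q, hq, hpq, hqK'⟩ := hK'.exists_isMinimalPattern
    (Fin.val_injective.comp σ.injective) hσ
  exact hqK' (h hq (hK.patPerm_mem_of_hasPattern hA (hpq.of_embedding e.toEmbedding)))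

protected theorem ext (hK : IsAmalgamationClass K) (hK' : IsAmalgamationClass K')
    (h12 : patPerm ![1, 2] ∈ K ↔ patPerm ![1, 2] ∈ K')
    (h21 : patPerm ![2, 1] ∈ K ↔ patPerm ![2, 1] ∈ K')
    (h213 : patPerm ![2, 1, 3] ∈ K ↔ patPerm ![2, 1, 3] ∈ K')
    (h231 : patPerm ![2, 3, 1] ∈ K ↔ patPerm ![2, 3, 1] ∈ K') : K = K' := by
  have h132 : ∀ {L}, IsAmalgamationClass.{w} L →
      (patPerm ![1, 3, 2] ∈ L ↔ patPerm ![2, 1, 3] ∈ L) :=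
    fun hL => ⟨hL.mem_213_of_mem_132, hL.mem_132_of_mem_213⟩
  have h312 : ∀ {L}, IsAmalgamationClass.{w} L →
      (patPerm ![3, 1, 2] ∈ L ↔ patPerm ![2, 3, 1] ∈ L) :=
    fun hL => ⟨hL.mem_231_of_mem_312, hL.mem_312_of_mem_231⟩
  have h : ∀ {n : ℕ} {q : Fin n → ℕ}, IsMinimalPattern q → (patPerm q ∈ K ↔ patPerm q ∈ K') := by
    rintro _ _ (_ | _ | _ | _ | _ | _ | _ | _)
    · exact h12
    · exact h21
    · rw [h132 hK, h132 hK', h213]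
    · exact h213
    · exact h231
    · rw [h312 hK, h312 hK', h231]
    · rw [hK.mem_2413_iff, hK'.mem_2413_iff, h213, h231]
    · rw [hK.mem_3142_iff, hK'.mem_3142_iff, h213, h231]
  exact (subset_of_forall_isMinimalPattern hK.toIsPermutationClass hK' fun hq => (h hq).1).antisymm
    (subset_of_forall_isMinimalPattern hK'.toIsPermutationClass hK fun hq => (h hq).2)

end IsAmalgamationClass

end AmalgamationClasses

section Classification

variable {K : Set (Bundled.{w} permLang.Structure)}

theorem IsPermutationClass.isAmalgamationClass (hK : IsPermutationClass K) (hR : IsRamseyClass K) :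
    IsAmalgamationClass K :=
  ⟨hK, hR.amalgamation hK.jointEmbedding⟩

theorem GridCoding.isAmalgamationClass (c : GridCoding K) : IsAmalgamationClass K :=
  c.isPermutationClass.isAmalgamationClass c.isRamseyClass

theorem IsAmalgamationClass.eq_trivialPerms (hK : IsAmalgamationClass K)
    (h12 : patPerm ![1, 2] ∉ K) (h21 : patPerm ![2, 1] ∉ K) : K = trivialPerms :=
  hK.ext trivialPermsCoding.isAmalgamationClass
    (iff_of_false h12 (patPerm_mem_trivialPerms_iff.not.2 (by decide)))
    (iff_of_false h21 (patPerm_mem_trivialPerms_iff.not.2 (by decide)))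
    (iff_of_false (fun h => h12 (hK.patPerm_mem_of_comp h ![0, 2] (by decide)))
      (patPerm_mem_trivialPerms_iff.not.2 (by decide)))
    (iff_of_false (fun h => h12 (hK.patPerm_mem_of_comp h ![0, 1] (by decide)))
      (patPerm_mem_trivialPerms_iff.not.2 (by decide)))

theorem IsAmalgamationClass.eq_identityPerms (hK : IsAmalgamationClass K)
    (h12 : patPerm ![1, 2] ∈ K) (h21 : patPerm ![2, 1] ∉ K) : K = identityPerms :=
  hK.ext identityPermsCoding.isAmalgamationClass
    (iff_of_true h12 (patPerm_mem_identityPerms_iff.2 (by decide)))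
    (iff_of_false h21 (patPerm_mem_identityPerms_iff.not.2 (by decide)))
    (iff_of_false (fun h => h21 (hK.patPerm_mem_of_comp h ![0, 1] (by decide)))
      (patPerm_mem_identityPerms_iff.not.2 (by decide)))
    (iff_of_false (fun h => h21 (hK.patPerm_mem_of_comp h ![0, 2] (by decide)))
      (patPerm_mem_identityPerms_iff.not.2 (by decide)))

theorem IsAmalgamationClass.eq_reversalPerms (hK : IsAmalgamationClass K)
    (h12 : patPerm ![1, 2] ∉ K) (h21 : patPerm ![2, 1] ∈ K) : K = reversalPerms :=
  hK.ext reversalPermsCoding.isAmalgamationClass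
    (iff_of_false h12 (patPerm_mem_reversalPerms_iff.not.2 (by decide)))
    (iff_of_true h21 (patPerm_mem_reversalPerms_iff.2 (by decide)))
    (iff_of_false (fun h => h12 (hK.patPerm_mem_of_comp h ![0, 2] (by decide)))
      (patPerm_mem_reversalPerms_iff.not.2 (by decide)))
    (iff_of_false (fun h => h12 (hK.patPerm_mem_of_comp h ![0, 1] (by decide)))
      (patPerm_mem_reversalPerms_iff.not.2 (by decide)))

theorem IsAmalgamationClass.eq_incDecPerms (hK : IsAmalgamationClass K)
    (h12 : patPerm ![1, 2] ∈ K) (h21 : patPerm ![2, 1] ∈ K) (h231 : patPerm ![2, 3, 1] ∉ K) :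
    K = incDecPerms :=
  hK.ext incDecPermsCoding.isAmalgamationClass
    (iff_of_true h12 (patPerm_mem_incDecPerms_iff.2 (by decide)))
    (iff_of_true h21 (patPerm_mem_incDecPerms_iff.2 (by decide)))
    (iff_of_true ((hK.mem_213_or_mem_231 h12 h21).resolve_right h231)
      (patPerm_mem_incDecPerms_iff.2 (by decide)))
    (iff_of_false h231 (patPerm_mem_incDecPerms_iff.not.2 (by decide)))

theorem IsAmalgamationClass.eq_decIncPerms (hK : IsAmalgamationClass K)
    (h12 : patPerm ![1, 2] ∈ K) (h21 : patPerm ![2, 1] ∈ K) (h213 : patPerm ![2, 1, 3] ∉ K) :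
    K = decIncPerms :=
  hK.ext decIncPermsCoding.isAmalgamationClass
    (iff_of_true h12 (patPerm_mem_decIncPerms_iff.2 (by decide)))
    (iff_of_true h21 (patPerm_mem_decIncPerms_iff.2 (by decide)))
    (iff_of_false h213 (patPerm_mem_decIncPerms_iff.not.2 (by decide)))
    (iff_of_true ((hK.mem_213_or_mem_231 h12 h21).resolve_left h213)
      (patPerm_mem_decIncPerms_iff.2 (by decide)))

theorem IsAmalgamationClass.eq_allPerms (hK : IsAmalgamationClass K)
    (h213 : patPerm ![2, 1, 3] ∈ K) (h231 : patPerm ![2, 3, 1] ∈ K) : K = allPerms :=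
  hK.ext allPermsCoding.isAmalgamationClass
    (iff_of_true (hK.patPerm_mem_of_comp h213 ![0, 2] (by decide))
      (patPerm_mem_allPerms_iff.2 (by decide)))
    (iff_of_true (hK.patPerm_mem_of_comp h213 ![0, 1] (by decide))
      (patPerm_mem_allPerms_iff.2 (by decide)))
    (iff_of_true h213 (patPerm_mem_allPerms_iff.2 (by decide)))
    (iff_of_true h231 (patPerm_mem_allPerms_iff.2 (by decide)))

theorem isAmalgamationClass_iff : IsAmalgamationClass K ↔
    K ∈ ({trivialPerms, identityPerms, reversalPerms, incDecPerms, decIncPerms, allPerms} :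
      Set (Set (Bundled.{w} permLang.Structure))) := by
  simp only [Set.mem_insert_iff, Set.mem_singleton_iff]
  constructor
  · intro hK
    by_cases h12 : patPerm ![1, 2] ∈ K <;> by_cases h21 : patPerm ![2, 1] ∈ K
    · by_cases h213 : patPerm ![2, 1, 3] ∈ K
      · by_cases h231 : patPerm ![2, 3, 1] ∈ K
        · simp only [hK.eq_allPerms h213 h231, or_true]
        · simp only [hK.eq_incDecPerms h12 h21 h231, true_or, or_true]
      · simp only [hK.eq_decIncPerms h12 h21 h213, true_or, or_true]
    · simp only [hK.eq_identityPerms h12 h21, true_or, or_true]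
    · simp only [hK.eq_reversalPerms h12 h21, true_or, or_true]
    · simp only [hK.eq_trivialPerms h12 h21, true_or]
  · rintro (rfl | rfl | rfl | rfl | rfl | rfl)
    exacts [trivialPermsCoding.isAmalgamationClass, identityPermsCoding.isAmalgamationClass,
      reversalPermsCoding.isAmalgamationClass, incDecPermsCoding.isAmalgamationClass,
      decIncPermsCoding.isAmalgamationClass, allPermsCoding.isAmalgamationClass]

theorem IsAmalgamationClass.nonempty_gridCoding (hK : IsAmalgamationClass K) :
    Nonempty (GridCoding K) := by
  rcases isAmalgamationClass_iff.1 hK with rfl | rfl | rfl | rfl | rfl | rfl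
  exacts [⟨trivialPermsCoding⟩, ⟨identityPermsCoding⟩, ⟨reversalPermsCoding⟩,
    ⟨incDecPermsCoding⟩, ⟨decIncPermsCoding⟩, ⟨allPermsCoding⟩]

theorem IsAmalgamationClass.isRamseyClass (hK : IsAmalgamationClass K) : IsRamseyClass K :=
  hK.nonempty_gridCoding.some.isRamseyClass

theorem isPermutationClass_and_isRamseyClass_iff :
    IsPermutationClass K ∧ IsRamseyClass K ↔ IsAmalgamationClass K :=
  ⟨fun ⟨hK, hR⟩ => hK.isAmalgamationClass hR, fun hK => ⟨hK.toIsPermutationClass, hK.isRamseyClass⟩⟩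

end Classification

section Ages

open FirstOrder.Language

variable {K : Set (Bundled.{w} permLang.Structure)}

theorem isPermutationClass_age {M : Type w} [permLang.Structure M] [Nonempty M]
    (hM : IsPermutation M) : IsPermutationClass (permLang.age M) where
  subset_allPerms := fun _ ⟨hfg, ⟨f⟩⟩ => ⟨Structure.fg_iff_finite.1 hfg, hM.of_embedding f⟩
  exists_nonempty := by
    obtain ⟨x⟩ := ‹Nonempty M›
    exact ⟨⟨Substructure.closure permLang {x}, inferInstance⟩,
      age.fg_substructure (Substructure.fg_closure_singleton x),
      ⟨⟨x, Substructure.subset_closure (Set.mem_singleton x)⟩⟩⟩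
  isoClosed := fun A B h => (age.is_equiv_invariant permLang M A B h).1
  hereditary := age.hereditary M
  jointEmbedding := age.jointEmbedding M

theorem isRamseyClass_age_of_isEmpty {M : Type w} [permLang.Structure M] [IsEmpty M] :
    IsRamseyClass (permLang.age M) := by
  rintro A ⟨-, ⟨f⟩⟩ B hB r
  have := Function.isEmpty f
  exact ⟨B, hB, partitionArrow_iff.2 fun χ =>
    ⟨χ (permEmbedding .ofIsEmpty fun _ x => isEmptyElim x), .refl permLang B, fun g =>
      congrArg χ (Embedding.ext fun x => isEmptyElim x)⟩⟩

theorem isRamseyClass_age {M : Type w} [permLang.Structure M] (hM : IsPermutation M)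
    (hhom : permLang.IsUltrahomogeneous M) : IsRamseyClass (permLang.age M) := by
  rcases isEmpty_or_nonempty M with _ | _
  · exact isRamseyClass_age_of_isEmpty
  · exact IsAmalgamationClass.isRamseyClass ⟨isPermutationClass_age hM, hhom.amalgamation_age⟩

theorem isPermutation_of_age_subset_allPerms {M : Type w} [permLang.Structure M]
    (hM : permLang.age M ⊆ allPerms) : IsPermutation M := by
  have hS (s : Set M) (hs : s.Finite) : IsPermutation (Substructure.closure permLang s) :=
    (hM (age.fg_substructure (Substructure.fg_closure hs))).2
  have hmem {s : Set M} {x : M} (hx : x ∈ s) : x ∈ Substructure.closure permLang s :=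
    Substructure.subset_closure hx
  have hlt {s : Set M} {i : Fin 2} {x y : M} (hx : x ∈ s) (hy : y ∈ s) : permLt i x y ↔
      permLt (M := Substructure.closure permLang s) i ⟨x, hmem hx⟩ ⟨y, hmem hy⟩ :=
    permLt_apply_apply (Substructure.closure permLang s).subtype (x := ⟨x, hmem hx⟩)
      (y := ⟨y, hmem hy⟩)
  intro i
  have hirrefl : Std.Irrefl (permLt (M := M) i) := ⟨fun x h =>
    have hx : x ∈ ({x} : Set M) := Set.mem_singleton x
    permLt_irrefl (hS {x} (Set.toFinite _)) i _ ((hlt hx hx).1 h)⟩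
  have htrans : IsTrans M (permLt i) := ⟨fun x y z hxy hyz => by
    have hx : x ∈ ({x, y, z} : Set M) := by simp
    have hy : y ∈ ({x, y, z} : Set M) := by simp
    have hz : z ∈ ({x, y, z} : Set M) := by simp
    exact (hlt hx hz).2
      (permLt_trans (hS _ (Set.toFinite _)) ((hlt hx hy).1 hxy) ((hlt hy hz).1 hyz))⟩
  have htrichotomous : Std.Trichotomous (permLt (M := M) i) := ⟨fun x y hxy hyx => by
    have hx : x ∈ ({x, y} : Set M) := by simp
    have hy : y ∈ ({x, y} : Set M) := by simp
    obtain h | h | h := permLt_trichotomous (hS {x, y} (Set.toFinite _)) i ⟨x, hmem hx⟩ ⟨y, hmem hy⟩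
    · exact absurd ((hlt hx hy).2 h) hxy
    · exact congrArg Subtype.val h
    · exact absurd ((hlt hy hx).2 h) hyx⟩
  exact { }

theorem countable_image_quotientMk (hK : K ⊆ allPerms) :
    (Quotient.mk (equivSetoid (L := permLang)) '' K).Countable := by
  refine (Set.countable_range fun σ : Σ n, Equiv.Perm (Fin n) =>
    Quotient.mk equivSetoid (patPerm.{w} fun i => (σ.2 i : ℕ))).mono ?_
  rintro _ ⟨A, hA, rfl⟩
  obtain ⟨σ, e⟩ := exists_perm_equiv_patPerm (hK hA)
  exact ⟨⟨_, σ⟩, Quotient.sound e⟩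

theorem IsAmalgamationClass.exists_isUltrahomogeneous_age_eq (hK : IsAmalgamationClass K) :
    ∃ M : Bundled.{w} permLang.Structure, Countable M ∧ IsPermutation M ∧
      permLang.IsUltrahomogeneous M ∧ permLang.age M = K := by
  have : IsFraisse K :=
    { is_nonempty := hK.exists_nonempty.imp fun _ h => h.1
      FG := fun A hA => have := (hK.subset_allPerms hA).1; Structure.FG.of_finite
      is_essentially_countable := countable_image_quotientMk hK.subset_allPerms
      hereditary := hK.hereditary
      jointEmbedding := hK.jointEmbedding
      amalgamation := hK.amalgamation }
  obtain ⟨M, hcount, hhom, hage⟩ := _root_.exists_isUltrahomogeneous_age_eq fun A hA =>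
    (hK.subset_allPerms hA).1
  exact ⟨M, hcount, isPermutation_of_age_subset_allPerms (hage ▸ hK.subset_allPerms), hhom, hage⟩

end Ages

section Counting

open FirstOrder.Language

variable {K : Set (Bundled.{w} permLang.Structure)}

theorem infinite_image_quotientMk_of_forall_card {L : FirstOrder.Language.{u, v}}
    {K : Set (Bundled.{w} L.Structure)} (hK : ∀ n, ∃ A ∈ K, Nat.card A = n) :
    (Quotient.mk equivSetoid '' K).Infinite := by
  let card : Quotient (equivSetoid (L := L)) → ℕ :=
    Quotient.lift (fun A => Nat.card A) fun A B ⟨e⟩ => Nat.card_congr e.toEquiv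
  refine Set.Infinite.of_image card (Set.infinite_univ.mono fun n _ => ?_)
  obtain ⟨A, hA, rfl⟩ := hK n
  exact ⟨_, ⟨A, hA, rfl⟩, rfl⟩

theorem infinite_image_quotientMk_identityPerms :
    (Quotient.mk equivSetoid '' identityPerms.{w}).Infinite :=
  infinite_image_quotientMk_of_forall_card fun N => ⟨chainPerm N, identityPermsCoding.grid_mem N,
    (Nat.card_ulift (Fin N)).trans (Nat.card_fin N)⟩

theorem infinite_image_quotientMk_reversalPerms :
    (Quotient.mk equivSetoid '' reversalPerms.{w}).Infinite :=
  infinite_image_quotientMk_of_forall_card fun N => ⟨flipPerm (chainPerm N),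
    reversalPerms_eq ▸ identityPermsCoding.flip.grid_mem N,
    (Nat.card_ulift (Fin N)).trans (Nat.card_fin N)⟩

theorem finite_image_quotientMk_trivialPerms :
    (Quotient.mk equivSetoid '' trivialPerms.{w}).Finite := by
  refine (Set.finite_range fun σ : Σ n : Fin 2, Equiv.Perm (Fin n) =>
    Quotient.mk equivSetoid (patPerm.{w} fun i => (σ.2 i : ℕ))).subset ?_
  rintro _ ⟨A, ⟨hA, hsub⟩, rfl⟩
  have := hA.1
  obtain ⟨σ, e⟩ := exists_perm_equiv_patPerm hA
  have hcard : Nat.card A < 2 :=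
    Nat.lt_succ_of_le (Finite.card_le_one_iff_subsingleton.2 hsub)
  exact ⟨⟨⟨_, hcard⟩, σ⟩, Quotient.sound e⟩

theorem IsAmalgamationClass.identityPerms_subset (hK : IsAmalgamationClass K)
    (h12 : patPerm ![1, 2] ∈ K) : identityPerms ⊆ K :=
  subset_of_forall_isMinimalPattern identityPermsCoding.isPermutationClass hK fun hq hqid => by
    cases hq
    case p12 => exact h12
    all_goals exact absurd hqid (patPerm_mem_identityPerms_iff.not.2 (by decide))

theorem IsAmalgamationClass.reversalPerms_subset (hK : IsAmalgamationClass K)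
    (h21 : patPerm ![2, 1] ∈ K) : reversalPerms ⊆ K :=
  subset_of_forall_isMinimalPattern reversalPermsCoding.isPermutationClass hK fun hq hqrev => by
    cases hq
    case p21 => exact h21
    all_goals exact absurd hqrev (patPerm_mem_reversalPerms_iff.not.2 (by decide))

theorem IsAmalgamationClass.isCountablyInfiniteClass_iff (hK : IsAmalgamationClass K) :
    IsCountablyInfiniteClass K ↔ K ≠ trivialPerms := by
  constructor
  · rintro h rfl
    exact h.1 finite_image_quotientMk_trivialPerms
  · refine fun hne => ⟨?_, countable_image_quotientMk hK.subset_allPerms⟩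
    by_cases h12 : patPerm ![1, 2] ∈ K
    · exact infinite_image_quotientMk_identityPerms.mono
        (Set.image_mono (hK.identityPerms_subset h12))
    · have h21 : patPerm ![2, 1] ∈ K := by_contra fun h21 => hne (hK.eq_trivialPerms h12 h21)
      exact infinite_image_quotientMk_reversalPerms.mono
        (Set.image_mono (hK.reversalPerms_subset h21))

theorem ncard_setOf_isAmalgamationClass :
    {K : Set (Bundled.{w} permLang.Structure) | IsAmalgamationClass K}.ncard = 6 := by
  let F : Fin 6 → Set (Bundled.{w} permLang.Structure) :=
    ![trivialPerms, identityPerms, reversalPerms, incDecPerms, decIncPerms, allPerms]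
  have hF : Set.range F = {K | IsAmalgamationClass K} := by
    ext K
    simp only [F, Matrix.range_cons, Matrix.range_empty, Set.union_empty, Set.singleton_union,
      Set.mem_ofPred_eq, isAmalgamationClass_iff]
  have hinj : Function.Injective F := fun i j hij => by
    have h12 := Set.ext_iff.1 hij (patPerm ![1, 2])
    have h21 := Set.ext_iff.1 hij (patPerm ![2, 1])
    have h213 := Set.ext_iff.1 hij (patPerm ![2, 1, 3])
    have h231 := Set.ext_iff.1 hij (patPerm ![2, 3, 1])
    clear hij
    fin_cases i <;> fin_cases j <;> first
      | rfl
      | (simp only [F, Fin.reduceFinMk, Matrix.cons_val, patPerm_mem_trivialPerms_iff,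
           patPerm_mem_identityPerms_iff, patPerm_mem_reversalPerms_iff,
           patPerm_mem_incDecPerms_iff, patPerm_mem_decIncPerms_iff, patPerm_mem_allPerms_iff]
           at h12 h21 h213 h231
         first
           | exact absurd h12 (by decide)
           | exact absurd h21 (by decide)
           | exact absurd h213 (by decide)
           | exact absurd h231 (by decide))
  rw [← hF, Set.ncard_range_of_injective hinj, Nat.card_fin]

end Counting

theorem mainTheorem1_general :
    (∀ (M : Type w) [permLang.Structure M],
      IsPermutation M → permLang.IsUltrahomogeneous M → IsRamseyClass (permLang.age M)) ∧
    (∀ K : Set (Bundled.{w} permLang.Structure), IsPermutationClass K →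
      (IsRamseyClass K ↔ ∃ M : Bundled.{w} permLang.Structure, Countable M ∧ IsPermutation M ∧
        permLang.IsUltrahomogeneous M ∧ permLang.age M = K)) ∧
    {K : Set (Bundled.{w} permLang.Structure) | IsPermutationClass K ∧ IsRamseyClass K} =
      {trivialPerms, identityPerms, reversalPerms, incDecPerms, decIncPerms, allPerms} ∧
    {K : Set (Bundled.{w} permLang.Structure) | IsPermutationClass K ∧ IsRamseyClass K ∧
      IsCountablyInfiniteClass K}.ncard = 5 := by
  refine ⟨fun M _ hM hhom => isRamseyClass_age hM hhom, fun K hK => ⟨fun hR =>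
    (hK.isAmalgamationClass hR).exists_isUltrahomogeneous_age_eq, ?_⟩, ?_, ?_⟩
  · rintro ⟨M, _, hM, hhom, rfl⟩
    exact isRamseyClass_age hM hhom
  · ext K
    exact isPermutationClass_and_isRamseyClass_iff.trans isAmalgamationClass_iff
  · have hset : {K : Set (Bundled.{w} permLang.Structure) | IsPermutationClass K ∧
        IsRamseyClass K ∧ IsCountablyInfiniteClass K} =
        {K | IsAmalgamationClass K} \ {trivialPerms} := by
      ext K
      change IsPermutationClass K ∧ IsRamseyClass K ∧ IsCountablyInfiniteClass K ↔
        IsAmalgamationClass K ∧ K ≠ trivialPerms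
      rw [← and_assoc, isPermutationClass_and_isRamseyClass_iff]
      exact and_congr_right fun hK => hK.isCountablyInfiniteClass_iff
    rw [hset, Set.ncard_sdiff_singleton_of_mem (a := trivialPerms)
      (s := {K | IsAmalgamationClass K}) trivialPermsCoding.isAmalgamationClass,
      ncard_setOf_isAmalgamationClass]

theorem mainTheorem1 :
    -- the age of each countable homogeneous permutation is a Ramsey class
    (∀ (M : Type w) [permLang.Structure M] [Countable M],
      IsPermutation M → permLang.IsUltrahomogeneous M → IsRamseyClass (permLang.age M)) ∧
    -- the Ramsey classes of permutations are exactly these ages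
    (∀ K : Set (Bundled.{w} permLang.Structure), IsPermutationClass K →
      (IsRamseyClass K ↔ ∃ M : Bundled.{w} permLang.Structure, Countable M ∧ IsPermutation M ∧
        permLang.IsUltrahomogeneous M ∧ permLang.age M = K)) ∧
    -- these are the following six classes
    {K : Set (Bundled.{w} permLang.Structure) | IsPermutationClass K ∧ IsRamseyClass K} =
      {trivialPerms, identityPerms, reversalPerms, incDecPerms, decIncPerms, allPerms} ∧
    -- exactly five of them are countably infinite
    {K : Set (Bundled.{w} permLang.Structure) | IsPermutationClass K ∧ IsRamseyClass K ∧
      IsCountablyInfiniteClass K}.ncard = 5 :=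
  ⟨fun M _ _ => mainTheorem1_general.1 M, mainTheorem1_general.2⟩
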